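/- Let $R$ be a left noetherian ring and let $e \in R$ be an idempotent. Let $\operatorname{mod} R$ be the category of finitely generated left $R$-modules and $\operatorname{proj} R$ the full subcategory of projective ones. Let $\mathbf K^{-,b}(\operatorname{proj} R)$ be the homotopy category of bounded above cochain complexes in $\operatorname{proj} R$ with bounded cohomology, let $\mathbf K^{b}(\operatorname{proj} R)$ be its full subcategory of perfect complexes, i.e. of those that are isomorphic in it to a bounded complex in $\operatorname{proj} R$, and let $\mathbf D_{\mathrm{sg}}(R) = \mathbf K^{-,b}(\operatorname{proj} R)/\mathbf K^{b}(\operatorname{proj} R)$ be the Verdier quotient (the singularity category of $R$); similarly for the ring $eRe$. Let $i_\lambda = Re\otimes_{eRe}-$ be the functor from left $eRe$-modules to left $R$-modules, and let $\operatorname{add} Re$ be the class of direct summands of finite direct sums of copies of the left $R$-module $Re$. Suppose that the right $eRe$-module $Re$ has finite projective dimension. Then the termwise application of $i_\lambda$ maps $\mathbf K^{-,b}(\operatorname{proj} eRe)$ to $\mathbf K^{-,b}(\operatorname{proj} R)$ and induces a fully faithful triangle functor $$\mathbf D_{\mathrm{sg}}(i_\lambda)\colon \mathbf D_{\mathrm{sg}}(eRe)\to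 \mathbf D_{\mathrm{sg}}(R),$$ that is, a fully faithful triangle functor which commutes, up to an isomorphism compatible with the shifts, with the quotient functors. Moreover, $\mathbf D_{\mathrm{sg}}(i_\lambda)$ is an equivalence if and only if for every $M \in \operatorname{mod} R$ there are an integer $\ell$ and a projective resolution $\cdots\to P^{-1}\to P^{0}\to M\to 0$ with all $P^{-i}$ in $\operatorname{proj} R$ such that $P^{-i}\in\operatorname{add} Re$ for every $i\ge \ell$. -/

import Mathlib

open CategoryTheory Limits TensorProduct

universe u

/-! ### The tensor product of a bimodule with a left module over noncommutative rings -/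

namespace SingCat

section Tensor

variable (R S : Type u) [Ring R] [Ring S] (B : Type u) [AddCommGroup B] [Module R B]
  [Module Sᵐᵒᵖ B] [SMulCommClass R Sᵐᵒᵖ B]

/-- The submodule of `B ⊗_ℤ N` generated by the elements `b s ⊗ n - b ⊗ s n`, for an
`R`-`S`-bimodule `B` and a left `S`-module `N`. The generating set is stable under `R`, so the
`R`-span is also the additive subgroup which it generates. -/
def tensorRel (N : Type u) [AddCommGroup N] [Module S N] : Submodule R (B ⊗[ℤ] N) :=
  Submodule.span R
    {t | ∃ (b : B) (s : S) (n : N), t = (MulOpposite.op s • b) ⊗ₜ[ℤ] n - b ⊗ₜ[ℤ] (s • n)}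

/-- The left `R`-module `B ⊗_S N`. -/
abbrev BimodTensor (N : Type u) [AddCommGroup N] [Module S N] : Type u :=
  (B ⊗[ℤ] N) ⧸ tensorRel R S B N

variable {S} in
/-- The map `B ⊗_S f`. -/
noncomputable def bimodTensorMap {N N' : Type u} [AddCommGroup N] [Module S N]
    [AddCommGroup N'] [Module S N'] (f : N →ₗ[S] N') :
    BimodTensor R S B N →ₗ[R] BimodTensor R S B N' :=
  Submodule.mapQ _ _
    (TensorProduct.AlgebraTensorModule.map (LinearMap.id : B →ₗ[R] B)
      f.toAddMonoidHom.toIntLinearMap)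
    (by
      rw [tensorRel, Submodule.span_le]
      rintro _ ⟨b, s, n, rfl⟩
      refine Submodule.subset_span ⟨b, s, f n, ?_⟩
      simp)

/-- The functor `B ⊗_S -` from left `S`-modules to left `R`-modules. -/
noncomputable def tensorFunctor : ModuleCat.{u} S ⥤ ModuleCat.{u} R where
  obj N := ModuleCat.of R (BimodTensor R S B N)
  map f := ModuleCat.ofHom (bimodTensorMap R B f.hom)
  map_id N := by
    refine ModuleCat.hom_ext (LinearMap.ext fun x ↦ ?_)
    obtain ⟨x, rfl⟩ := Submodule.Quotient.mk_surjective _ x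
    induction x using TensorProduct.induction_on with
    | zero => rw [Submodule.Quotient.mk_zero, map_zero, map_zero]
    | tmul b n => rfl
    | add x y hx hy => rw [Submodule.Quotient.mk_add, map_add, map_add, hx, hy]
  map_comp f g := by
    refine ModuleCat.hom_ext (LinearMap.ext fun x ↦ ?_)
    obtain ⟨x, rfl⟩ := Submodule.Quotient.mk_surjective _ x
    induction x using TensorProduct.induction_on with
    | zero => rw [Submodule.Quotient.mk_zero, map_zero, map_zero]
    | tmul b n => rfl
    | add x y hx hy => rw [Submodule.Quotient.mk_add, map_add, map_add, hx, hy]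

variable {S} in
lemma bimodTensorMap_add {N N' : Type u} [AddCommGroup N] [Module S N]
    [AddCommGroup N'] [Module S N'] (f g : N →ₗ[S] N') :
    bimodTensorMap R B (f + g) = bimodTensorMap R B f + bimodTensorMap R B g := by
  refine LinearMap.ext fun x ↦ ?_
  obtain ⟨x, rfl⟩ := Submodule.Quotient.mk_surjective _ x
  induction x using TensorProduct.induction_on with
  | zero => rw [Submodule.Quotient.mk_zero, map_zero, map_zero]
  | tmul b n => exact congrArg Submodule.Quotient.mk (TensorProduct.tmul_add b _ _)
  | add x y hx hy => rw [Submodule.Quotient.mk_add, map_add, map_add, hx, hy]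

instance : (tensorFunctor R S B).Additive where
  map_add {_ _ f g} := ModuleCat.hom_ext (bimodTensorMap_add R B f.hom g.hom)

end Tensor

/-! ### The bimodule `Re` -/

section Corner

variable {R : Type u} [Ring R] {e : R}

/-- The left ideal `Re`. -/
abbrev LeftRe (_he : IsIdempotentElem e) : Type u := ↥(Ideal.span {e} : Ideal R)

lemma mul_corner_mem (x : R) {he : IsIdempotentElem e} (a : he.Corner) :
    x * a.1 ∈ (Ideal.span {e} : Ideal R) := by
  rw [Ideal.mem_span_singleton']
  exact ⟨x * a.1, by rw [mul_assoc, ((Subsemigroup.mem_corner_iff he).mp a.2).2]⟩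

lemma mul_idem_of_mem (he : IsIdempotentElem e) {x : R} (hx : x ∈ (Ideal.span {e} : Ideal R)) :
    x * e = x := by
  obtain ⟨r, rfl⟩ := Ideal.mem_span_singleton'.mp hx
  rw [mul_assoc, he.eq]

/-- `Re` is a right module over the corner ring `eRe`, by right multiplication in `R`. -/
instance (he : IsIdempotentElem e) : Module (he.Corner)ᵐᵒᵖ (LeftRe he) where
  smul a x := ⟨x.1 * a.unop.1, mul_corner_mem _ _⟩
  one_smul x := Subtype.ext (mul_idem_of_mem he x.2)
  mul_smul a b x := Subtype.ext (mul_assoc x.1 b.unop.1 a.unop.1).symm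
  smul_zero _ := Subtype.ext (zero_mul _)
  smul_add _ _ _ := Subtype.ext (add_mul _ _ _)
  add_smul _ _ _ := Subtype.ext (mul_add _ _ _)
  zero_smul _ := Subtype.ext (mul_zero _)

instance (he : IsIdempotentElem e) : SMulCommClass R (he.Corner)ᵐᵒᵖ (LeftRe he) where
  smul_comm r a x := Subtype.ext (mul_assoc r x.1 a.unop.1).symm

/-- The functor `i_λ = Re ⊗_{eRe} -` from left `eRe`-modules to left `R`-modules. -/
noncomputable def iLam (he : IsIdempotentElem e) : ModuleCat.{u} he.Corner ⥤ ModuleCat.{u} R :=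
  tensorFunctor R he.Corner (LeftRe he)

instance (he : IsIdempotentElem e) : (iLam he).Additive := by
  unfold iLam; infer_instance

/-- `add Re`: the direct summands of finite direct sums of copies of `Re`. -/
def addRe (he : IsIdempotentElem e) : ObjectProperty (ModuleCat.{u} R) :=
  fun M ↦ ∃ n : ℕ, Nonempty (Retract M (ModuleCat.of R (Fin n → LeftRe he)))

end Corner

/-! ### The singularity category -/

section Sing

open HomologicalComplex CochainComplex Pretriangulated

/-- A property of cochain complexes that holds for `0` and is stable under shifts and mapping
cones defines a triangulated subcategory of the homotopy category. -/
lemma isTriangulated_of_mappingCone {C : Type*} [Category* C] [Preadditive C] [HasZeroObject C]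
    [HasBinaryBiproducts C] (P : ObjectProperty (CochainComplex C ℤ))
    (h0 : ∀ K : CochainComplex C ℤ, IsZero K → P K)
    (hs : ∀ (K : CochainComplex C ℤ) (n : ℤ), P K → P (K⟦n⟧))
    (hc : ∀ {K L : CochainComplex C ℤ} (f : K ⟶ L), P K → P L → P (mappingCone f)) :
    ObjectProperty.IsTriangulated
      (fun X : HomotopyCategory C (ComplexShape.up ℤ) ↦ P X.as) := by
  set Q : ObjectProperty (HomotopyCategory C (ComplexShape.up ℤ)) := fun X ↦ P X.as
  have : Q.ContainsZero := by
    obtain ⟨Z, hZ⟩ := HasZeroObject.zero (C := CochainComplex C ℤ)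
    exact ⟨⟨(HomotopyCategory.quotient _ _).obj Z, Functor.map_isZero _ hZ, h0 Z hZ⟩⟩
  have : Q.IsStableUnderShift ℤ := ⟨fun n ↦ ⟨fun K hK ↦ by
    obtain ⟨K : CochainComplex C ℤ, rfl⟩ := K.quotient_obj_surjective
    rw [ObjectProperty.prop_shift_iff, HomotopyCategory.shift_quotient_obj]
    exact hs K n hK⟩⟩
  have : Q.IsTriangulatedClosed₃ := ⟨fun T hT h₁ h₂ ↦ by
    obtain ⟨f : T.obj₁.as ⟶ T.obj₂.as, hf⟩ :=
      (HomotopyCategory.quotient _ _).map_surjective T.mor₁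
    refine ⟨(HomotopyCategory.quotient _ _).obj (mappingCone f), hc f h₁ h₂,
      ⟨Triangle.π₃.mapIso (isoTriangleOfIso₁₂ T _ hT
        (HomotopyCategory.mappingCone_triangleh_distinguished f)
        (Iso.refl _) (Iso.refl _) ?_)⟩⟩
    exact (Category.comp_id _).trans (hf.symm.trans (Category.id_comp _).symm)⟩
  exact { toIsTriangulatedClosed₂ := .of_isTriangulatedClosed₃ }

variable (R : Type u) [Ring R]

/-- The cochain complexes in `proj R`: all terms are finitely generated projective. -/
def complexProj : ObjectProperty (CochainComplex (ModuleCat.{u} R) ℤ) :=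
  fun K ↦ ∀ i, Module.Finite R (K.X i) ∧ Module.Projective R (K.X i)

/-- The bounded above complexes in `proj R` with bounded cohomology. (As the complexes are
bounded above, so is their cohomology; it remains to ask that the cohomology in all
sufficiently negative degrees vanishes.) -/
def complexMb : ObjectProperty (CochainComplex (ModuleCat.{u} R) ℤ) :=
  fun K ↦ complexProj R K ∧ (∃ n, K.IsStrictlyLE n) ∧ (∃ n, K.IsGE n)

/-- The bounded complexes in `proj R`. -/
def complexBd : ObjectProperty (CochainComplex (ModuleCat.{u} R) ℤ) :=
  fun K ↦ complexProj R K ∧ (∃ n, K.IsStrictlyLE n) ∧ (∃ n, K.IsStrictlyGE n)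

/-- The objects of `K^{-,b}(proj R)`, inside the homotopy category of complexes of modules. -/
def Kmb : ObjectProperty (HomotopyCategory (ModuleCat.{u} R) (ComplexShape.up ℤ)) :=
  fun X ↦ complexMb R X.as

/-- The bounded complexes in `proj R`, inside the homotopy category of complexes of modules. -/
def Kbd : ObjectProperty (HomotopyCategory (ModuleCat.{u} R) (ComplexShape.up ℤ)) :=
  fun X ↦ complexBd R X.as

variable {R}

lemma complexProj_isZero (K : CochainComplex (ModuleCat.{u} R) ℤ) (hK : IsZero K) :
    complexProj R K := fun i ↦ by
  have := ModuleCat.subsingleton_of_isZero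
    (Functor.map_isZero (HomologicalComplex.eval _ (ComplexShape.up ℤ) i) hK)
  have : Subsingleton (K.X i) := this
  exact ⟨inferInstance, inferInstance⟩

lemma complexProj_mappingCone {K L : CochainComplex (ModuleCat.{u} R) ℤ} (f : K ⟶ L)
    (hK : complexProj R K) (hL : complexProj R L) : complexProj R (mappingCone f) := fun i ↦ by
  let iso : (mappingCone f).X i ≅ ModuleCat.of R (K.X (i + 1) × L.X i) :=
    homotopyCofiber.XIsoBiprod f i (i + 1) rfl ≪≫ ModuleCat.biprodIsoProd _ _
  obtain ⟨_, _⟩ := hK (i + 1)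
  obtain ⟨_, _⟩ := hL i
  exact ⟨Module.Finite.equiv iso.toLinearEquiv.symm,
    Module.Projective.of_equiv iso.toLinearEquiv.symm⟩

lemma isStrictlyLE_mappingCone {K L : CochainComplex (ModuleCat.{u} R) ℤ} (f : K ⟶ L)
    (n₁ n₂ : ℤ) [K.IsStrictlyLE n₁] [L.IsStrictlyLE n₂] :
    (mappingCone f).IsStrictlyLE (max n₁ n₂) := by
  rw [isStrictlyLE_iff]
  intro i hi
  simp only [max_lt_iff] at hi
  simp only [mappingCone.isZero_X_iff]
  exact ⟨K.isZero_of_isStrictlyLE n₁ _ (by lia), L.isZero_of_isStrictlyLE n₂ _ (by lia)⟩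

lemma isGE_mappingCone {K L : CochainComplex (ModuleCat.{u} R) ℤ} (f : K ⟶ L)
    (n₁ n₂ : ℤ) [K.IsGE n₁] [L.IsGE n₂] :
    (mappingCone f).IsGE (min (n₁ - 1) n₂) := by
  rw [isGE_iff]
  intro i hi
  simp only [lt_min_iff] at hi
  have key (M : CochainComplex (ModuleCat.{u} R) ℤ) (j : ℤ) :
      IsZero ((HomotopyCategory.homologyFunctor (ModuleCat.{u} R) (ComplexShape.up ℤ) j).obj
        ((HomotopyCategory.quotient _ _).obj M)) ↔ M.ExactAt j := by
    rw [HomologicalComplex.exactAt_iff_isZero_homology]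
    exact ((HomotopyCategory.homologyFunctorFactors _ _ j).app M).isZero_iff
  rw [← key]
  have ex := (HomotopyCategory.homologyFunctor (ModuleCat.{u} R) (ComplexShape.up ℤ)
    0).homologySequence_exact₃ _ (HomotopyCategory.mappingCone_triangleh_distinguished f)
    i (i + 1) rfl
  exact ex.isZero_of_both_zeros
    (((key L i).mpr (L.exactAt_of_isGE n₂ i (by lia))).eq_of_src _ _)
    (((key K (i + 1)).mpr (K.exactAt_of_isGE n₁ (i + 1) (by lia))).eq_of_tgt _ _)

instance : (Kmb R).IsTriangulated :=
  isTriangulated_of_mappingCone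
    (complexMb R)
    (fun K hK ↦ ⟨complexProj_isZero K hK,
      ⟨0, (isStrictlyLE_iff _ _).2 fun i _ ↦
        Functor.map_isZero (HomologicalComplex.eval _ (ComplexShape.up ℤ) i) hK⟩,
      ⟨0, (isGE_iff _ _).2 fun i _ ↦ (HomologicalComplex.exactAt_iff_isZero_homology _ _).2
        (Functor.map_isZero (HomologicalComplex.homologyFunctor _ (ComplexShape.up ℤ) i) hK)⟩⟩)
    (fun K n ⟨h₁, ⟨a, _⟩, ⟨b, _⟩⟩ ↦ ⟨fun i ↦ h₁ (i + n),
      ⟨a - n, K.isStrictlyLE_shift a n (a - n) (by lia)⟩,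
      ⟨b - n, K.isGE_shift b n (b - n) (by lia)⟩⟩)
    (fun f ⟨h₁, ⟨a₁, _⟩, ⟨b₁, _⟩⟩ ⟨h₂, ⟨a₂, _⟩, ⟨b₂, _⟩⟩ ↦
      ⟨complexProj_mappingCone f h₁ h₂, ⟨_, isStrictlyLE_mappingCone f a₁ a₂⟩,
        ⟨_, isGE_mappingCone f b₁ b₂⟩⟩)

instance : (Kbd R).IsTriangulated :=
  isTriangulated_of_mappingCone
    (complexBd R)
    (fun K hK ↦ ⟨complexProj_isZero K hK,
      ⟨0, (isStrictlyLE_iff _ _).2 fun i _ ↦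
        Functor.map_isZero (HomologicalComplex.eval _ (ComplexShape.up ℤ) i) hK⟩,
      ⟨0, (isStrictlyGE_iff _ _).2 fun i _ ↦
        Functor.map_isZero (HomologicalComplex.eval _ (ComplexShape.up ℤ) i) hK⟩⟩)
    (fun K n ⟨h₁, ⟨a, _⟩, ⟨b, _⟩⟩ ↦ ⟨fun i ↦ h₁ (i + n),
      ⟨a - n, K.isStrictlyLE_shift a n (a - n) (by lia)⟩,
      ⟨b - n, K.isStrictlyGE_shift b n (b - n) (by lia)⟩⟩)
    (fun f ⟨h₁, ⟨a₁, _⟩, ⟨b₁, _⟩⟩ ⟨h₂, ⟨a₂, _⟩, ⟨b₂, _⟩⟩ ↦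
      ⟨complexProj_mappingCone f h₁ h₂, ⟨_, isStrictlyLE_mappingCone f a₁ a₂⟩,
        ⟨min (b₁ - 1) b₂, isStrictlyGE_mappingCone f b₁ b₂ _ (by simp) (by simp)⟩⟩)

variable (R)

/-- The category `K^{-,b}(proj R)`. -/
abbrev KmbCat : Type _ := (Kmb R).FullSubcategory

/-- The perfect complexes in `K^{-,b}(proj R)`: those that are isomorphic in the homotopy
category to a bounded complex in `proj R`. (Between bounded above complexes of projectives,
isomorphisms in the derived category and in the homotopy category are the same.) -/
abbrev perfect : ObjectProperty (KmbCat R) := (Kbd R).isoClosure.inverseImage (Kmb R).ι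

/-- The singularity category `D_sg(R)`: the Verdier quotient of `K^{-,b}(proj R)` by the
perfect complexes. -/
abbrev DSg : Type _ := (perfect R).trW.Localization

/-- The Verdier quotient functor `K^{-,b}(proj R) ⥤ D_sg(R)`. -/
abbrev quot : KmbCat R ⥤ DSg R := (perfect R).trW.Q

end Sing

section Lift

variable {R : Type u} [Ring R] {e : R} (he : IsIdempotentElem e)

/-- The termwise extension of `i_λ` to a functor `K^{-,b}(proj eRe) ⥤ K^{-,b}(proj R)`, for
which `i_λ` has to map the objects of the former to objects of the latter. -/
noncomputable abbrev iLamKmb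
    (h : ∀ X, Kmb he.Corner X → Kmb R (((iLam he).mapHomotopyCategory (ComplexShape.up ℤ)).obj X)) :
    KmbCat he.Corner ⥤ KmbCat R :=
  (Kmb R).lift ((Kmb he.Corner).ι ⋙ (iLam he).mapHomotopyCategory (ComplexShape.up ℤ))
    (fun X ↦ h _ X.property)

end Lift

end SingCat

/-! Write `i_λ = Re ⊗ -`. The map `n ↦ e ⊗ n` identifies `N` with `e (Re ⊗ N)`, so `i_λ` is fully
faithful; it identifies `proj eRe` with `add Re`, and its termwise extension to homotopy categories
is again fully faithful. If `Re` has projective dimension at most `n` as a right module, dimension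
shifting shows that tensoring a complex of finitely generated projectives with `Re` moves the bound
below which it is exact down by at most `n` (`tensorExactAt_of_hasProjectiveDimensionLE`). Hence
`K^{-,b}` is preserved, and bounded complexes are visibly preserved.

A fully faithful functor stays fully faithful on Verdier quotients if every map from a perfect
complex to `i_λ Y` factors through `i_λ Z` with `Z` perfect (`exists_fullyFaithful_verdier_lift`).
Here a map from a complex in degrees `≥ k` lands in the brutal truncation of `i_λ Y` in degrees `≥
k`, which is `i_λ` of a bounded complex (`exists_factorization_iLamKmb`).

For the equivalence, every object of `D_sg(R)` is, up to shift, a finitely generated projective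
resolution of a finitely generated module, and cutting off finitely many terms does not change it.
If the tail lies in `add Re`, it lifts to `eRe`, where its cohomology is still bounded because `i_λ`
reflects exactness (`essSurj_of_resolutions`). Conversely, the complexes homotopy equivalent to one
with terms eventually in `add Re` form a triangulated subcategory containing the perfect complexes.
Since perfect complexes are closed under retracts, such a subcategory is closed under isomorphism in
`D_sg(R)` (`prop_of_quot_iso`). So a resolution of `M` isomorphic there to some `i_λ X` is homotopy
equivalent to a complex with tail in `add Re`, and truncating the latter resolves `M`
(`exists_addRe_resolution`). -/

namespace SingCat

/-! ### Full faithfulness on Verdier quotients. -/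

section Verdier

open Category Pretriangulated ObjectProperty

variable {C₁ C₂ D₁ D₂ : Type*} [Category* C₁] [Category* C₂] [Category* D₁] [Category* D₂]
  [HasZeroObject C₁] [HasShift C₁ ℤ] [Preadditive C₁]
  [∀ (n : ℤ), (shiftFunctor C₁ n).Additive] [Pretriangulated C₁]
  [HasZeroObject C₂] [HasShift C₂ ℤ] [Preadditive C₂]
  [∀ (n : ℤ), (shiftFunctor C₂ n).Additive] [Pretriangulated C₂]

/-- Denominators with source in the image of a triangulated functor are dominated by
denominators coming from the source category, if maps from the subcategory `B` to the image
factor through `A`. -/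
lemma exists_trW_of_factorization (G : C₁ ⥤ C₂) [G.CommShift ℤ] [G.IsTriangulated]
    (A : ObjectProperty C₁) [A.IsTriangulated] (B : ObjectProperty C₂) [B.IsTriangulated]
    (fac : ∀ ⦃W : C₂⦄ ⦃Y : C₁⦄ (f : W ⟶ G.obj Y), B W →
      ∃ (Z : C₁) (a : W ⟶ G.obj Z) (b : Z ⟶ Y), A Z ∧ a ≫ G.map b = f)
    {X : C₁} {Y : C₂} (s : G.obj X ⟶ Y) (hs : B.trW s) :
    ∃ (Z : C₁) (s' : X ⟶ Z) (b : Y ⟶ G.obj Z), A.trW s' ∧ s ≫ b = G.map s' := by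
  rw [trW_iff'] at hs
  obtain ⟨W, a, b, hT, hW⟩ := hs
  obtain ⟨W', c, d, hW', hcd⟩ := fac a hW
  obtain ⟨U, e, f, hT'⟩ := Pretriangulated.distinguished_cocone_triangle d
  -- The new denominator is the cone of `d : W' ⟶ X`; the factorization of `a` through `G.map d`
  -- induces a map between the two cones.
  obtain ⟨g, hg, _⟩ := Pretriangulated.complete_distinguished_triangle_morphism _ _ hT
    (G.map_distinguished _ hT') c (𝟙 _) ((comp_id a).trans hcd.symm)
  refine ⟨U, e, g, ?_, ?_⟩
  · rw [trW_iff']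
    exact ⟨_, _, _, hT', hW'⟩
  · exact hg.trans (id_comp _)

variable [IsTriangulated C₂] (G : C₁ ⥤ C₂) [G.CommShift ℤ] [G.IsTriangulated]
  (A : ObjectProperty C₁) [A.IsTriangulated] (B : ObjectProperty C₂) [B.IsTriangulated]
  (fac : ∀ ⦃W : C₂⦄ ⦃Y : C₁⦄ (f : W ⟶ G.obj Y), B W →
      ∃ (Z : C₁) (a : W ⟶ G.obj Z) (b : Z ⟶ Y), A Z ∧ a ≫ G.map b = f)
  (L₁ : C₁ ⥤ D₁) (L₂ : C₂ ⥤ D₂) [L₁.IsLocalization A.trW] [L₂.IsLocalization B.trW]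
  (F : D₁ ⥤ D₂) (iso : L₁ ⋙ F ≅ G ⋙ L₂)

include fac iso

/-- A fraction between objects in the image of `G` can be rewritten with a denominator `G.map s'`;
fullness of `G` then lifts its numerator. -/
lemma full_of_factorization [G.Full] : F.Full := by
  have : L₁.EssSurj := Localization.essSurj L₁ A.trW
  refine F.full_of_comp_essSurj L₁ (fun X₁ X₂ φ ↦ ?_)
  let φ' : L₂.obj (G.obj X₁) ⟶ L₂.obj (G.obj X₂) := iso.inv.app X₁ ≫ φ ≫ iso.hom.app X₂
  obtain ⟨f, hf⟩ := Localization.exists_leftFraction L₂ B.trW φ'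
  obtain ⟨X₃, s', a, hs', hfac⟩ := exists_trW_of_factorization G A B fac f.s f.hs
  obtain ⟨g', hg'⟩ := G.map_surjective (f.f ≫ a)
  let g : A.trW.LeftFraction X₁ X₂ := { Y' := X₃, f := g', s := s', hs := hs' }
  have := Localization.inverts L₁ _ _ g.hs
  have hiso := Localization.inverts L₂ _ _ f.hs
  have key : φ' ≫ L₂.map (G.map s') = L₂.map (G.map g') := by
    rw [hf, ← hfac, hg', L₂.map_comp, L₂.map_comp,
      MorphismProperty.LeftFraction.map_comp_map_s_assoc]
  refine ⟨g.map L₁ (Localization.inverts _ _), ?_⟩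
  rw [← cancel_mono (F.map (L₁.map g.s)), ← Functor.map_comp,
    MorphismProperty.LeftFraction.map_comp_map_s, ← cancel_epi (iso.inv.app X₁),
    ← cancel_mono (iso.hom.app X₃)]
  have e₁ : F.map (L₁.map g') ≫ iso.hom.app X₃ = iso.hom.app X₁ ≫ L₂.map (G.map g') :=
    iso.hom.naturality g'
  have e₂ : F.map (L₁.map s') ≫ iso.hom.app X₃ = iso.hom.app X₂ ≫ L₂.map (G.map s') :=
    iso.hom.naturality s'
  have e₃ : iso.inv.app X₁ ≫ iso.hom.app X₁ = 𝟙 (L₂.obj (G.obj X₁)) := iso.inv_hom_id_app X₁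
  change (iso.inv.app X₁ ≫ F.map (L₁.map g')) ≫ iso.hom.app X₃ =
    (iso.inv.app X₁ ≫ φ ≫ F.map (L₁.map s')) ≫ iso.hom.app X₃
  rw [assoc, assoc, assoc, e₁, e₂, ← key, reassoc_of% e₃]
  simp [φ']

/-- By additivity only zero maps matter. A map killed in the quotient is killed by a denominator,
which may be taken in the image of `G`, and faithfulness brings the relation back to `C₁`. -/
lemma faithful_of_factorization [IsTriangulated C₁] [G.Faithful] : F.Faithful := by
  let := Localization.preadditive L₁ A.trW
  let := Localization.preadditive L₂ B.trW
  have := Localization.functor_additive L₁ A.trW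
  have := Localization.functor_additive L₂ B.trW
  have : (L₁ ⋙ F).Additive := Functor.additive_of_iso iso.symm
  have : F.Additive := by
    rw [Localization.functor_additive_iff L₁ A.trW]
    infer_instance
  refine Functor.faithful_of_comp_cancel_zero_of_hasLeftCalculusOfFractions L₁
    A.trW F (fun X₁ X₂ f hf ↦ ?_)
  replace hf : L₂.map (G.map f) = L₂.map 0 := by
    have e₁ : F.map (L₁.map f) ≫ iso.hom.app X₂ = iso.hom.app X₁ ≫ L₂.map (G.map f) :=
      iso.hom.naturality f
    rw [hf, zero_comp] at e₁
    rw [← cancel_epi (iso.hom.app X₁), L₂.map_zero, comp_zero]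
    exact e₁.symm
  rw [MorphismProperty.map_eq_iff_postcomp L₂ B.trW] at hf
  obtain ⟨X₃, s, hs, hs'⟩ := hf
  obtain ⟨X₄, t, a, ht, hfac⟩ := exists_trW_of_factorization G A B fac s hs
  have := Localization.inverts L₁ A.trW t ht
  rw [← cancel_mono (L₁.map t), zero_comp, ← L₁.map_comp]
  have : f ≫ t = 0 := G.map_injective (by
    rw [G.map_comp, ← hfac, reassoc_of% hs', zero_comp, G.map_zero])
  rw [this, L₁.map_zero]

end Verdier

section VerdierLift

open Category Pretriangulated ObjectProperty

variable {C₁ C₂ : Type*} [Category* C₁] [Category* C₂]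
  [HasZeroObject C₁] [HasShift C₁ ℤ] [Preadditive C₁]
  [∀ (n : ℤ), (shiftFunctor C₁ n).Additive] [Pretriangulated C₁]
  [HasZeroObject C₂] [HasShift C₂ ℤ] [Preadditive C₂]
  [∀ (n : ℤ), (shiftFunctor C₂ n).Additive] [Pretriangulated C₂]
  [IsTriangulated C₁] [IsTriangulated C₂]

/-- A triangulated functor which is fully faithful and for which maps from the subcategory `B`
to its image factor through `A` induces a fully faithful functor on Verdier quotients. -/
lemma exists_fullyFaithful_verdier_lift (G : C₁ ⥤ C₂) [G.CommShift ℤ] [G.IsTriangulated]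
    [G.Full] [G.Faithful] (A : ObjectProperty C₁) [A.IsTriangulated]
    (B : ObjectProperty C₂) [B.IsTriangulated] [B.IsClosedUnderIsomorphisms]
    (hAB : A ≤ B.inverseImage G)
    (fac : ∀ ⦃W : C₂⦄ ⦃Y : C₁⦄ (f : W ⟶ G.obj Y), B W →
      ∃ (Z : C₁) (a : W ⟶ G.obj Z) (b : Z ⟶ Y), A Z ∧ a ≫ G.map b = f) :
    ∃ (F : A.trW.Localization ⥤ B.trW.Localization) (_ : F.CommShift ℤ)
      (α : A.trW.Q ⋙ F ≅ G ⋙ B.trW.Q),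
      NatTrans.CommShift α.hom ℤ ∧ F.IsTriangulated ∧ F.Full ∧ F.Faithful := by
  have hinv : A.trW.IsInvertedBy (G ⋙ B.trW.Q) := fun X Y f hf ↦
    B.inverseImage_trW_isInverted G B.trW.Q _ (trW_monotone hAB _ hf)
  let F := Localization.lift (G ⋙ B.trW.Q) hinv A.trW.Q
  let cs : F.CommShift ℤ :=
    Functor.commShiftOfLocalization A.trW.Q A.trW ℤ (G ⋙ B.trW.Q) F
  let α : A.trW.Q ⋙ F ≅ G ⋙ B.trW.Q := Localization.Lifting.iso A.trW.Q A.trW _ _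
  have hα : NatTrans.CommShift α.hom ℤ :=
    NatTrans.commShift_iso_hom_of_localization A.trW.Q A.trW ℤ (G ⋙ B.trW.Q) F
  -- Every arrow of the quotient is isomorphic to one coming from `C₁`, so triangulatedness of `F`
  -- can be tested on triangles of `C₁`.
  have : A.trW.Q.mapArrow.EssSurj := Localization.essSurj_mapArrow A.trW.Q A.trW
  exact ⟨F, cs, α, hα, Functor.isTriangulated_of_precomp_iso α,
    full_of_factorization G A B fac A.trW.Q B.trW.Q F α,
    faithful_of_factorization G A B fac A.trW.Q B.trW.Q F α⟩

end VerdierLift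

/-! ### Brutal truncations. -/

section Truncation

open Category HomologicalComplex CochainComplex Pretriangulated

variable {C : Type*} [Category* C] [Preadditive C]

/-- The subcomplex whose terms are the retracts `Y i` of the terms of `K`. -/
@[simps]
def retractSub (K : CochainComplex C ℤ) (Y : ℤ → C) (a : ∀ i, Y i ⟶ K.X i)
    (b : ∀ i, K.X i ⟶ Y i)
    (h : ∀ i, a i ≫ K.d i (i + 1) ≫ b (i + 1) ≫ a (i + 1) = a i ≫ K.d i (i + 1)) :
    CochainComplex C ℤ where
  X := Y
  d i j := a i ≫ K.d i j ≫ b j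
  shape i j hij := by rw [K.shape _ _ hij, zero_comp, comp_zero]
  d_comp_d' i j k hij hjk := by
    obtain rfl : i + 1 = j := hij
    have := h i
    simp only [assoc]
    rw [reassoc_of% this, K.d_comp_d_assoc, zero_comp, comp_zero]

/-- The inclusion of the subcomplex `retractSub`. -/
@[simps]
def retractSubι (K : CochainComplex C ℤ) (Y : ℤ → C) (a : ∀ i, Y i ⟶ K.X i)
    (b : ∀ i, K.X i ⟶ Y i)
    (h : ∀ i, a i ≫ K.d i (i + 1) ≫ b (i + 1) ≫ a (i + 1) = a i ≫ K.d i (i + 1)) :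
    retractSub K Y a b h ⟶ K where
  f := a
  comm' i j hij := by
    obtain rfl : i + 1 = j := hij
    have e : (a i ≫ K.d i (i + 1) ≫ b (i + 1)) ≫ a (i + 1) = a i ≫ K.d i (i + 1) := by
      rw [assoc, assoc, h i]
    exact e.symm

/-- The quotient complex whose terms are the retracts `Y i` of the terms of `K`. -/
@[simps]
def retractQuot (K : CochainComplex C ℤ) (Y : ℤ → C) (a : ∀ i, Y i ⟶ K.X i)
    (b : ∀ i, K.X i ⟶ Y i)
    (h : ∀ i, b i ≫ a i ≫ K.d i (i + 1) ≫ b (i + 1) = K.d i (i + 1) ≫ b (i + 1)) :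
    CochainComplex C ℤ where
  X := Y
  d i j := a i ≫ K.d i j ≫ b j
  shape i j hij := by rw [K.shape _ _ hij, zero_comp, comp_zero]
  d_comp_d' i j k hij hjk := by
    obtain rfl : i + 1 = j := hij
    obtain rfl : i + 1 + 1 = k := hjk
    simp only [assoc]
    rw [h (i + 1), K.d_comp_d_assoc, zero_comp, comp_zero]

/-- The projection onto the quotient complex `retractQuot`. -/
@[simps]
def retractQuotπ (K : CochainComplex C ℤ) (Y : ℤ → C) (a : ∀ i, Y i ⟶ K.X i)
    (b : ∀ i, K.X i ⟶ Y i)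
    (h : ∀ i, b i ≫ a i ≫ K.d i (i + 1) ≫ b (i + 1) = K.d i (i + 1) ≫ b (i + 1)) :
    K ⟶ retractQuot K Y a b h where
  f := b
  comm' i j hij := by
    obtain rfl : i + 1 = j := hij
    exact h i

variable [HasZeroObject C]

/-- Keeps the case distinction out of the differential: both truncations can use `a ≫ K.d ≫ b` in
all degrees. -/
lemma exists_retract_of_prop (K : CochainComplex C ℤ) (p : ℤ → Prop) :
    ∃ (Y : ℤ → C) (a : ∀ i, Y i ⟶ K.X i) (b : ∀ i, K.X i ⟶ Y i),
      (∀ i, p i → a i ≫ b i = 𝟙 _ ∧ b i ≫ a i = 𝟙 _) ∧ ∀ i, ¬ p i → IsZero (Y i) := by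
  have (i : ℤ) : ∃ (Y : C) (a : Y ⟶ K.X i) (b : K.X i ⟶ Y),
      (p i → a ≫ b = 𝟙 _ ∧ b ≫ a = 𝟙 _) ∧ (¬ p i → IsZero Y) := by
    by_cases h : p i
    · exact ⟨K.X i, 𝟙 _, 𝟙 _, fun _ ↦ by simp, fun h' ↦ (h' h).elim⟩
    · obtain ⟨Z, hZ⟩ := HasZeroObject.zero (C := C)
      exact ⟨Z, 0, 0, fun h' ↦ (h h').elim, fun _ ↦ hZ⟩
  choose Y a b h₁ h₂ using this
  exact ⟨Y, a, b, h₁, h₂⟩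

/-- The brutal truncation `σ^{≥ k} K → K`. -/
lemma exists_brutalGE (K : CochainComplex C ℤ) (k : ℤ) :
    ∃ (T : CochainComplex C ℤ) (ι : T ⟶ K), (∀ i, k ≤ i → IsIso (ι.f i)) ∧
      ∀ i, i < k → IsZero (T.X i) := by
  obtain ⟨Y, a, b, h₁, h₂⟩ := exists_retract_of_prop K (fun i ↦ k ≤ i)
  refine ⟨retractSub K Y a b fun i ↦ ?_, retractSubι K Y a b _,
    fun i hi ↦ ⟨b i, (h₁ i hi).1, (h₁ i hi).2⟩, fun i hi ↦ h₂ i (by lia)⟩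
  by_cases hi : k ≤ i
  · rw [(h₁ (i + 1) (by lia)).2, comp_id]
  · exact (h₂ i hi).eq_of_src _ _

/-- The brutal truncation `K → σ^{≤ k} K`. -/
lemma exists_brutalLE (K : CochainComplex C ℤ) (k : ℤ) :
    ∃ (T : CochainComplex C ℤ) (π : K ⟶ T), (∀ i, i ≤ k → IsIso (π.f i)) ∧
      ∀ i, k < i → IsZero (T.X i) := by
  obtain ⟨Y, a, b, h₁, h₂⟩ := exists_retract_of_prop K (fun i ↦ i ≤ k)
  refine ⟨retractQuot K Y a b fun i ↦ ?_, retractQuotπ K Y a b _,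
    fun i hi ↦ ⟨a i, (h₁ i hi).2, (h₁ i hi).1⟩, fun i hi ↦ h₂ i (by lia)⟩
  by_cases hi : i + 1 ≤ k
  · rw [reassoc_of% (h₁ i (by lia)).2]
  · exact (h₂ (i + 1) hi).eq_of_tgt _ _

omit [HasZeroObject C] in
/-- A map from a complex concentrated in degrees `≥ k` lifts to the brutal truncation. -/
lemma exists_lift_of_isIso_f {K T B : CochainComplex C ℤ} (ι : T ⟶ K) (k : ℤ)
    (hι : ∀ i, k ≤ i → IsIso (ι.f i)) (hB : ∀ i, i < k → IsZero (B.X i)) (f : B ⟶ K) :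
    ∃ g : B ⟶ T, g ≫ ι = f := by
  have (i : ℤ) : ∃ g : B.X i ⟶ T.X i, g ≫ ι.f i = f.f i := by
    by_cases hi : k ≤ i
    · have := hι i hi
      exact ⟨f.f i ≫ inv (ι.f i), by simp⟩
    · exact ⟨0, (hB i (by lia)).eq_of_src _ _⟩
  choose g hg using this
  refine ⟨{ f := g, comm' := fun i j hij ↦ ?_ }, by ext i; exact hg i⟩
  obtain rfl : i + 1 = j := hij
  by_cases hi : k ≤ i
  · have := hι (i + 1) (by lia)
    rw [← cancel_mono (ι.f (i + 1)), assoc, assoc, ← ι.comm, reassoc_of% (hg i), hg (i + 1),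
      f.comm]
  · exact (hB i (by lia)).eq_of_src _ _

variable [HasBinaryBiproducts C]

/-- Complementary brutal truncations fit in a distinguished triangle. -/
lemma exists_distinguished_of_brutal {K T' T'' : CochainComplex C ℤ} (ι : T' ⟶ K) (π : K ⟶ T'')
    (k : ℤ) (hι : ∀ i, k < i → IsIso (ι.f i)) (hT' : ∀ i, i ≤ k → IsZero (T'.X i))
    (hπ : ∀ i, i ≤ k → IsIso (π.f i)) (hT'' : ∀ i, k < i → IsZero (T''.X i)) :
    ∃ δ, Triangle.mk ((HomotopyCategory.quotient C (ComplexShape.up ℤ)).map ι)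
      ((HomotopyCategory.quotient C (ComplexShape.up ℤ)).map π) δ ∈ distTriang _ := by
  let S : ShortComplex (CochainComplex C ℤ) := ShortComplex.mk ι π (by
    ext i
    by_cases hi : i ≤ k
    · exact (hT' i hi).eq_of_src _ _
    · exact (hT'' i (by lia)).eq_of_tgt _ _)
  have (n : ℤ) : Nonempty (S.map (eval C _ n)).Splitting := by
    by_cases hn : n ≤ k
    · obtain ⟨p, hp₁, hp₂⟩ := (hπ n hn).out
      exact ⟨{ r := 0
               s := p
               f_r := (hT' n hn).eq_of_src _ _
               s_g := hp₂
               id := by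
                change (0 : K.X n ⟶ T'.X n) ≫ ι.f n + π.f n ≫ p = 𝟙 (K.X n)
                rw [zero_comp, zero_add]
                exact hp₁ }⟩
    · obtain ⟨p, hp₁, hp₂⟩ := (hι n (by lia)).out
      exact ⟨{ r := p
               s := 0
               f_r := hp₁
               s_g := (hT'' n (by lia)).eq_of_src _ _
               id := by
                change p ≫ ι.f n + π.f n ≫ (0 : T''.X n ⟶ K.X n) = 𝟙 (K.X n)
                rw [comp_zero, add_zero]
                exact hp₂ }⟩
  let σ n := (this n).some
  exact ⟨_, (HomotopyCategory.distinguished_iff_iso_trianglehOfDegreewiseSplit _).2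
    ⟨S, σ, ⟨Iso.refl _⟩⟩⟩

end Truncation

/-! ### Computing with elements of `B ⊗_S N`. -/

section TensorElements

variable {R S : Type u} [Ring R] [Ring S] {B : Type u} [AddCommGroup B] [Module R B]
  [Module Sᵐᵒᵖ B] {N N' : Type u} [AddCommGroup N] [Module S N] [AddCommGroup N'] [Module S N']

variable (R S) in
/-- The class of `b ⊗ n` in `B ⊗_S N`. -/
def tmk (b : B) (n : N) : BimodTensor R S B N := Submodule.Quotient.mk (b ⊗ₜ[ℤ] n)

@[elab_as_elim]
lemma tmk_induction {p : BimodTensor R S B N → Prop} (zero : p 0)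
    (tmk : ∀ b n, p (tmk R S b n)) (add : ∀ x y, p x → p y → p (x + y)) (x) : p x := by
  obtain ⟨x, rfl⟩ := Submodule.Quotient.mk_surjective _ x
  induction x using TensorProduct.induction_on with
  | zero => exact zero
  | tmul b n => exact tmk b n
  | add x y hx hy => exact add _ _ hx hy

lemma tmk_add_left (b b' : B) (n : N) : tmk R S (b + b') n = tmk R S b n + tmk R S b' n :=
  congrArg Submodule.Quotient.mk (add_tmul b b' n)

lemma tmk_add_right (b : B) (n n' : N) : tmk R S b (n + n') = tmk R S b n + tmk R S b n' :=
  congrArg Submodule.Quotient.mk (tmul_add b n n')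

lemma smul_tmk (r : R) (b : B) (n : N) : r • tmk R S b n = tmk R S (r • b) n := rfl

lemma tmk_op_smul (s : S) (b : B) (n : N) :
    tmk R S (MulOpposite.op s • b) n = tmk R S b (s • n) :=
  (Submodule.Quotient.eq _).2 (Submodule.subset_span ⟨b, s, n, rfl⟩)

lemma bimodTensorMap_tmk (f : N →ₗ[S] N') (b : B) (n : N) :
    bimodTensorMap R B f (tmk R S b n) = tmk R S b (f n) := rfl

variable (R S) in
/-- The map `n ↦ b ⊗ n`. -/
@[simps]
def tmkHom (b : B) : N →+ BimodTensor R S B N where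
  toFun := tmk R S b
  map_zero' := congrArg Submodule.Quotient.mk (tmul_zero N b)
  map_add' := tmk_add_right b

variable (R S) in
/-- The map `b ↦ b ⊗ n`. -/
@[simps]
def tmkHomLeft (n : N) : B →+ BimodTensor R S B N where
  toFun b := tmk R S b n
  map_zero' := congrArg Submodule.Quotient.mk (zero_tmul B n)
  map_add' b b' := tmk_add_left b b' n

variable [SMulCommClass R Sᵐᵒᵖ B] {G : Type*} [AddCommGroup G]

variable (R) in
/-- The additive map on `B ⊗_S N` defined by a balanced biadditive map. -/
noncomputable def tensorLift (f : B →+ N →+ G)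
    (hf : ∀ b (s : S) n, f (MulOpposite.op s • b) n = f b (s • n)) :
    BimodTensor R S B N →+ G :=
  QuotientAddGroup.lift (tensorRel R S B N).toAddSubgroup
    (TensorProduct.liftAddHom f (fun k b n ↦ by simp)) (by
      -- The relations are an `R`-span while the map is only additive, so the induction has to carry
      -- all multiples `r • x`.
      suffices ∀ x ∈ tensorRel R S B N, ∀ r : R,
          TensorProduct.liftAddHom f (fun (k : ℤ) b n ↦ by simp) (r • x) = 0 by
        intro x hx
        simpa using this x hx 1
      intro x hx
      induction hx using Submodule.span_induction with
      | mem x hx =>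
        obtain ⟨b, s, n, rfl⟩ := hx
        intro r
        rw [smul_sub, smul_tmul', smul_tmul', map_sub, liftAddHom_tmul, liftAddHom_tmul,
          smul_comm, hf, sub_self]
      | zero => simp
      | add x y _ _ hx hy =>
        intro r
        rw [smul_add, map_add, hx, hy, add_zero]
      | smul a x _ hx =>
        intro r
        rw [smul_smul]
        exact hx _)

end TensorElements

/-! ### Full faithfulness of `i_λ`. -/

section CornerFunctor

variable {R : Type u} [Ring R] {e : R} (he : IsIdempotentElem e)

/-- The idempotent `e` as an element of `Re`. -/
def idemRe : LeftRe he := ⟨e, Ideal.mem_span_singleton_self e⟩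

/-- The element `e x` of the corner ring, for `x ∈ Re`. -/
def toCorner : LeftRe he →+ he.Corner where
  toFun x := ⟨e * x.1, (Subsemigroup.mem_corner_iff he).2
    ⟨by rw [← mul_assoc, he.eq], by rw [mul_assoc, mul_idem_of_mem he x.2]⟩⟩
  map_zero' := Subtype.ext (mul_zero e)
  map_add' _ _ := Subtype.ext (mul_add e _ _)

lemma smul_idemRe (x : LeftRe he) : x.1 • idemRe he = x :=
  Subtype.ext (mul_idem_of_mem he x.2)

lemma toCorner_idemRe : toCorner he (idemRe he) = 1 := Subtype.ext he.eq

lemma toCorner_op_smul (a : he.Corner) (x : LeftRe he) :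
    toCorner he (MulOpposite.op a • x) = toCorner he x * a :=
  Subtype.ext (mul_assoc e x.1 a.1).symm

lemma toCorner_smul (a : he.Corner) (x : LeftRe he) :
    toCorner he (a.1 • x) = a * toCorner he x := by
  refine Subtype.ext ?_
  change e * (a.1 * x.1) = a.1 * (e * x.1)
  have h := (Subsemigroup.mem_corner_iff he).mp a.2
  rw [← mul_assoc, ← mul_assoc, h.1, h.2]

lemma op_toCorner_smul_idemRe (x : LeftRe he) :
    MulOpposite.op (toCorner he x) • idemRe he = e • x := by
  refine Subtype.ext ?_
  change e * (e * x.1) = e * x.1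
  rw [← mul_assoc, he.eq]

lemma op_smul_idemRe (a : he.Corner) : MulOpposite.op a • idemRe he = a.1 • idemRe he := by
  refine Subtype.ext ?_
  change e * a.1 = a.1 * e
  have h := (Subsemigroup.mem_corner_iff he).mp a.2
  rw [h.1, h.2]

variable {N N' : Type u} [AddCommGroup N] [Module he.Corner N] [AddCommGroup N']
  [Module he.Corner N']

variable (N) in
/-- The additive retraction `x ⊗ n ↦ (e x) n` of the unit `n ↦ e ⊗ n`. -/
noncomputable def cornerRetraction : BimodTensor R he.Corner (LeftRe he) N →+ N :=
  tensorLift R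
    { toFun x :=
        { toFun n := toCorner he x • n
          map_zero' := smul_zero _
          map_add' := smul_add _ }
      map_zero' := AddMonoidHom.ext fun n ↦
        (congrArg (· • n) (toCorner he).map_zero).trans (zero_smul he.Corner n)
      map_add' x y := by ext; simp [add_smul] }
    (fun x a n ↦ by simp [toCorner_op_smul, mul_smul])

lemma cornerRetraction_tmk (x : LeftRe he) (n : N) :
    cornerRetraction he N (tmk R he.Corner x n) = toCorner he x • n := rfl

lemma cornerRetraction_idemRe (n : N) :
    cornerRetraction he N (tmk R he.Corner (idemRe he) n) = n := by
  rw [cornerRetraction_tmk, toCorner_idemRe, one_smul]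

lemma cornerRetraction_smul (a : he.Corner) (t : BimodTensor R he.Corner (LeftRe he) N) :
    cornerRetraction he N (a.1 • t) = a • cornerRetraction he N t := by
  induction t using tmk_induction with
  | zero => simp
  | tmk x n => rw [smul_tmk, cornerRetraction_tmk, toCorner_smul, mul_smul, cornerRetraction_tmk]
  | add x y hx hy => rw [smul_add, map_add, hx, hy, map_add, smul_add]

/-- Together with `cornerRetraction_idemRe` this identifies `N` with `e (Re ⊗ N)`. -/
lemma tmk_cornerRetraction (t : BimodTensor R he.Corner (LeftRe he) N) :
    tmk R he.Corner (idemRe he) (cornerRetraction he N t) = e • t := by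
  induction t using tmk_induction with
  | zero => simpa using (tmkHom R he.Corner (idemRe he)).map_zero
  | tmk x n => rw [cornerRetraction_tmk, ← tmk_op_smul, op_toCorner_smul_idemRe, smul_tmk]
  | add x y hx hy => rw [map_add, tmk_add_right, hx, hy, smul_add]

lemma cornerRetraction_naturality (f : N →ₗ[he.Corner] N')
    (t : BimodTensor R he.Corner (LeftRe he) N) :
    cornerRetraction he N' (bimodTensorMap R (LeftRe he) f t) =
      f (cornerRetraction he N t) := by
  induction t using tmk_induction with
  | zero => simp
  | tmk x n => rw [bimodTensorMap_tmk, cornerRetraction_tmk, cornerRetraction_tmk, map_smul]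
  | add x y hx hy => rw [map_add, map_add, hx, hy, map_add, map_add]

instance : (iLam he).Faithful where
  map_injective {N N'} f g h := by
    ext n
    have h' : bimodTensorMap R (LeftRe he) f.hom (tmk R he.Corner (idemRe he) n) =
        bimodTensorMap R (LeftRe he) g.hom (tmk R he.Corner (idemRe he) n) :=
      congrArg (fun φ ↦ φ.hom (tmk R he.Corner (idemRe he) n)) h
    rw [bimodTensorMap_tmk, bimodTensorMap_tmk] at h'
    simpa only [cornerRetraction_idemRe] using congrArg (cornerRetraction he N') h'

/-- The map on `N` induced by a map `Re ⊗ N → Re ⊗ N'`. -/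
noncomputable def cornerPreimage (f : BimodTensor R he.Corner (LeftRe he) N →ₗ[R]
    BimodTensor R he.Corner (LeftRe he) N') : N →ₗ[he.Corner] N' where
  toFun n := cornerRetraction he N' (f (tmk R he.Corner (idemRe he) n))
  map_add' n n' := by rw [tmk_add_right, map_add, map_add]
  map_smul' a n := by
    rw [← tmk_op_smul, op_smul_idemRe, ← smul_tmk, map_smul, cornerRetraction_smul,
      RingHom.id_apply]

/-- Since `x ⊗ n = x (e ⊗ n)`, an `R`-linear map is determined on the elements `e ⊗ n`; the factor
`e` produced by `tmk_cornerRetraction` is absorbed by `x e = x`. -/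
lemma bimodTensorMap_cornerPreimage (f : BimodTensor R he.Corner (LeftRe he) N →ₗ[R]
    BimodTensor R he.Corner (LeftRe he) N') :
    bimodTensorMap R (LeftRe he) (cornerPreimage he f) = f := by
  refine LinearMap.ext fun t ↦ ?_
  induction t using tmk_induction with
  | zero => simp
  | tmk x n =>
    rw [bimodTensorMap_tmk, ← smul_idemRe he x, ← smul_tmk, ← smul_tmk, map_smul]
    change x.1 • tmk R he.Corner (idemRe he)
      (cornerRetraction he N' (f (tmk R he.Corner (idemRe he) n))) = _
    rw [tmk_cornerRetraction, smul_smul, mul_idem_of_mem he x.2]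
  | add x y hx hy => rw [map_add, map_add, hx, hy]

instance : (iLam he).Full where
  map_surjective f :=
    ⟨ModuleCat.ofHom (cornerPreimage he f.hom),
      ModuleCat.hom_ext (bimodTensorMap_cornerPreimage he f.hom)⟩

/-- `Re ⊗ (eRe)^n ≃ (Re)^n`. -/
noncomputable def iLamFree (n : ℕ) :
    BimodTensor R he.Corner (LeftRe he) (Fin n → he.Corner) ≃ₗ[R] (Fin n → LeftRe he) := by
  let f : BimodTensor R he.Corner (LeftRe he) (Fin n → he.Corner) →+ (Fin n → LeftRe he) :=
    tensorLift R
      { toFun x :=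
          { toFun v j := MulOpposite.op (v j) • x
            map_zero' := funext fun _ ↦ zero_smul (he.Corner)ᵐᵒᵖ x
            map_add' v w := by ext; simp [add_smul] }
        map_zero' := by ext; simp
        map_add' x y := by ext; simp }
      (fun x a v ↦ by ext j : 1; simp [mul_smul])
  refine LinearEquiv.ofLinearMap
    { toFun := f
      map_add' := f.map_add
      map_smul' r t := ?_ }
    { toFun w := ∑ j, tmk R he.Corner (w j) (Pi.single j 1)
      map_add' v w := by simp [tmk_add_left, Finset.sum_add_distrib]
      map_smul' r w := by simp [← smul_tmk, Finset.smul_sum] } ?_ ?_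
  · induction t using tmk_induction with
    | zero => simp
    | tmk x v =>
      ext j : 1
      exact (smul_comm r (MulOpposite.op (v j)) x).symm
    | add x y hx hy =>
      rw [smul_add, map_add, hx, hy, map_add, smul_add]
  · refine LinearMap.ext fun w ↦ funext fun j ↦ ?_
    change f (∑ j, tmk R he.Corner (w j) (Pi.single j 1)) j = w j
    rw [map_sum, Finset.sum_apply, Finset.sum_eq_single j]
    · change MulOpposite.op ((Pi.single j 1 : Fin n → he.Corner) j) • w j = w j
      simp
    · intro k _ hk
      change MulOpposite.op ((Pi.single k 1 : Fin n → he.Corner) j) • w k = 0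
      rw [Pi.single_eq_of_ne' hk]
      exact zero_smul (he.Corner)ᵐᵒᵖ (w k)
    · simp
  · refine LinearMap.ext fun t ↦ ?_
    change ∑ j, tmk R he.Corner (f t j) (Pi.single j 1) = t
    induction t using tmk_induction with
    | zero =>
      exact Finset.sum_eq_zero fun j _ ↦ by
        rw [map_zero]
        exact (tmkHomLeft R he.Corner _).map_zero
    | tmk x v =>
      have (j : Fin n) : tmk R he.Corner (f (tmk R he.Corner x v) j) (Pi.single j 1) =
          tmkHom R he.Corner x (Pi.single j (v j) : Fin n → he.Corner) := by
        change tmk R he.Corner (MulOpposite.op (v j) • x) (Pi.single j 1) = _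
        rw [tmk_op_smul, ← Pi.single_smul, smul_eq_mul, mul_one]
        rfl
      rw [Finset.sum_congr rfl fun j _ ↦ this j, ← map_sum, Finset.univ_sum_single]
      rfl
    | add x y hx hy =>
      conv_rhs => rw [← hx, ← hy]
      rw [map_add, ← Finset.sum_add_distrib]
      simp [tmk_add_left]

end CornerFunctor

lemma finite_projective_of_retract {R : Type u} [Ring R] {M N : ModuleCat.{u} R}
    (r : Retract M N) (h : Module.Finite R N ∧ Module.Projective R N) :
    Module.Finite R M ∧ Module.Projective R M := by
  obtain ⟨_, _⟩ := h
  have hr : r.r.hom ∘ₗ r.i.hom = LinearMap.id := by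
    rw [← ModuleCat.hom_comp, r.retract, ModuleCat.hom_id]
  exact ⟨Module.Finite.of_surjective r.r.hom fun x ↦ ⟨r.i.hom x, LinearMap.congr_fun hr x⟩,
    Module.Projective.of_split r.i.hom r.r.hom hr⟩

lemma exists_retract_pi {R : Type u} [Ring R] (M : ModuleCat.{u} R) [Module.Finite R M]
    [Module.Projective R M] :
    ∃ n : ℕ, Nonempty (Retract M (ModuleCat.of R (Fin n → R))) := by
  obtain ⟨n, f, g, _, _, h⟩ := Module.Finite.exists_comp_eq_id_of_projective R M
  exact ⟨n, ⟨{ i := ModuleCat.ofHom g, r := ModuleCat.ofHom f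
               retract := ModuleCat.hom_ext h }⟩⟩

/-! ### `add Re` as the image of `proj eRe`. -/

section AddRe

variable {R : Type u} [Ring R] {e : R} (he : IsIdempotentElem e)

lemma addRe_of_retract {M N : ModuleCat.{u} R} (r : Retract M N) (h : addRe he N) :
    addRe he M := by
  obtain ⟨n, ⟨s⟩⟩ := h
  exact ⟨n, ⟨r.trans s⟩⟩

lemma addRe_of_isZero {M : ModuleCat.{u} R} (hM : IsZero M) : addRe he M :=
  ⟨0, ⟨{ i := 0, r := 0, retract := hM.eq_of_src _ _ }⟩⟩

lemma addRe_prod {M N : ModuleCat.{u} R} (hM : addRe he M) (hN : addRe he N) :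
    addRe he (M ⊞ N) := by
  obtain ⟨m, ⟨r⟩⟩ := hM
  obtain ⟨n, ⟨s⟩⟩ := hN
  let φ : ModuleCat.of R (Fin m → LeftRe he) ⊞ ModuleCat.of R (Fin n → LeftRe he) ≅
      ModuleCat.of R (Fin (m + n) → LeftRe he) :=
    ModuleCat.biprodIsoProd _ _ ≪≫ LinearEquiv.toModuleIso
      ((LinearEquiv.sumArrowLequivProdArrow (Fin m) (Fin n) R (LeftRe he)).symm ≪≫ₗ
        LinearEquiv.funCongrLeft R (LeftRe he) finSumFinEquiv.symm)
  refine ⟨m + n, ⟨{ i := biprod.map r.i s.i ≫ φ.hom, r := φ.inv ≫ biprod.map r.r s.r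
                    retract := ?_ }⟩⟩
  have : biprod.map r.i s.i ≫ biprod.map r.r s.r = 𝟙 _ := by
    apply biprod.hom_ext' <;> simp
  simpa using this

lemma finite_projective_leftRe (n : ℕ) :
    Module.Finite R (Fin n → LeftRe he) ∧ Module.Projective R (Fin n → LeftRe he) := by
  let r : Retract (ModuleCat.of R (LeftRe he)) (ModuleCat.of R R) :=
    { i := ModuleCat.ofHom (Submodule.subtype _)
      r := ModuleCat.ofHom
        { toFun x := ⟨x * e, Ideal.mem_span_singleton'.2 ⟨x, rfl⟩⟩
          map_add' x y := Subtype.ext (add_mul x y e)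
          map_smul' x y := Subtype.ext (mul_assoc x y e) }
      retract := ModuleCat.hom_ext (LinearMap.ext fun x : LeftRe he ↦
        Subtype.ext (mul_idem_of_mem he x.2)) }
  have : Module.Finite R (LeftRe he) ∧ Module.Projective R (LeftRe he) :=
    finite_projective_of_retract r ⟨inferInstanceAs (Module.Finite R R),
      inferInstanceAs (Module.Projective R R)⟩
  obtain ⟨_, _⟩ := this
  exact ⟨inferInstance, Module.Projective.of_equiv
    (DFinsupp.linearEquivFunOnFintype (R := R) (M := fun _ : Fin n ↦ LeftRe he))⟩

lemma finite_projective_of_addRe {M : ModuleCat.{u} R} (h : addRe he M) :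
    Module.Finite R M ∧ Module.Projective R M := by
  obtain ⟨n, ⟨r⟩⟩ := h
  exact finite_projective_of_retract r (finite_projective_leftRe he n)

lemma addRe_iLam (N : ModuleCat.{u} he.Corner) [Module.Finite he.Corner N]
    [Module.Projective he.Corner N] : addRe he ((iLam he).obj N) := by
  obtain ⟨n, ⟨r⟩⟩ := exists_retract_pi N
  exact ⟨n, ⟨(r.map (iLam he)).trans (Retract.ofIso (iLamFree he n).toModuleIso)⟩⟩

/-- A summand of `(Re)^n` is cut out by an idempotent, which full faithfulness moves to `(eRe)^n`,
where it splits. -/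
lemma exists_iLam_iso {M : ModuleCat.{u} R} (h : addRe he M) :
    ∃ N : ModuleCat.{u} he.Corner, (Module.Finite he.Corner N ∧ Module.Projective he.Corner N) ∧
      Nonempty ((iLam he).obj N ≅ M) := by
  obtain ⟨n, ⟨r⟩⟩ := h
  let φ : (iLam he).obj (ModuleCat.of he.Corner (Fin n → he.Corner)) ≅
    ModuleCat.of R (Fin n → LeftRe he) := (iLamFree he n).toModuleIso
  obtain ⟨q, hq⟩ := (iLam he).map_surjective (φ.hom ≫ r.r ≫ r.i ≫ φ.inv)
  have hqq : q ≫ q = q := (iLam he).map_injective (by simp [hq])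
  obtain ⟨N, i, p, hip, hpi⟩ := IsIdempotentComplete.idempotents_split _ q hqq
  have h₁ : (iLam he).map i ≫ (iLam he).map p = 𝟙 _ := by
    rw [← Functor.map_comp, hip, (iLam he).map_id]
  have h₂ : (iLam he).map p ≫ (iLam he).map i = φ.hom ≫ r.r ≫ r.i ≫ φ.inv := by
    rw [← Functor.map_comp, hpi, hq]
  refine ⟨N, finite_projective_of_retract ⟨i, p, hip⟩
    ⟨inferInstanceAs (Module.Finite _ (Fin n → he.Corner)),
      inferInstanceAs (Module.Projective _ (Fin n → he.Corner))⟩,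
    ⟨{ hom := (iLam he).map i ≫ φ.hom ≫ r.r
       inv := r.i ≫ φ.inv ≫ (iLam he).map p
       hom_inv_id := ?_
       inv_hom_id := ?_ }⟩⟩
  · have : (iLam he).map i ≫ (φ.hom ≫ r.r ≫ r.i ≫ φ.inv) ≫ (iLam he).map p = 𝟙 _ := by
      rw [← h₂, Category.assoc, h₁, Category.comp_id, h₁]
    simpa using this
  · simp only [Category.assoc]
    rw [reassoc_of% h₂]
    simp

end AddRe

/-- A complex whose terms are in the essential image of a fully faithful functor lifts. -/
lemma exists_mapHomologicalComplex_iso {C D : Type*} [Category* C] [Category* D]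
    [Preadditive C] [Preadditive D] (F : C ⥤ D) [F.Additive] [F.Full] [F.Faithful]
    (P : ObjectProperty C) (Q : CochainComplex D ℤ)
    (h : ∀ i, ∃ N, P N ∧ Nonempty (F.obj N ≅ Q.X i)) :
    ∃ Y : CochainComplex C ℤ, (∀ i, P (Y.X i)) ∧
      Nonempty ((F.mapHomologicalComplex (ComplexShape.up ℤ)).obj Y ≅ Q) := by
  choose N hN φ using h
  let φ i := (φ i).some
  let Y : CochainComplex C ℤ :=
    { X := N
      d i j := F.preimage ((φ i).hom ≫ Q.d i j ≫ (φ j).inv)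
      shape i j hij := F.map_injective (by simp [Q.shape _ _ hij])
      d_comp_d' i j k _ _ := F.map_injective (by simp) }
  refine ⟨Y, hN, ⟨HomologicalComplex.Hom.isoOfComponents φ fun i j _ ↦ ?_⟩⟩
  change (φ i).hom ≫ Q.d i j = F.map (F.preimage _) ≫ (φ j).hom
  simp

/-! ### Reflection of exactness by `i_λ`. -/

section Exactness

variable {R : Type u} [Ring R]

lemma exactAt_iff_moduleCat (K : CochainComplex (ModuleCat.{u} R) ℤ) (i j k : ℤ)
    (hij : i + 1 = j) (hjk : j + 1 = k) :
    K.ExactAt j ↔ ∀ x : K.X j, K.d j k x = 0 → ∃ y : K.X i, K.d i j y = x := by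
  rw [HomologicalComplex.exactAt_iff' K i j k (by simp; lia) (by simp; lia),
    ShortComplex.moduleCat_exact_iff]
  rfl

variable {e : R} (he : IsIdempotentElem e)

/-- The additive retraction is natural, so it sends a preimage of `e ⊗ x` under the differential to
a preimage of `x`. -/
lemma exactAt_of_iLam (K : CochainComplex (ModuleCat.{u} he.Corner) ℤ) (j : ℤ)
    (h : (((iLam he).mapHomologicalComplex (ComplexShape.up ℤ)).obj K).ExactAt j) :
    K.ExactAt j := by
  rw [exactAt_iff_moduleCat _ (j - 1) j (j + 1) (by lia) rfl] at h ⊢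
  intro x hx
  obtain ⟨y, hy⟩ := h (tmk R he.Corner (idemRe he) x) (by
    change bimodTensorMap R (LeftRe he) (K.d j (j + 1)).hom (tmk R he.Corner (idemRe he) x) = 0
    rw [bimodTensorMap_tmk]
    exact (congrArg (tmkHom R he.Corner (idemRe he)) hx).trans (map_zero _))
  refine ⟨cornerRetraction he _ y, ?_⟩
  have := cornerRetraction_naturality he (K.d (j - 1) j).hom y
  refine this.symm.trans ((congrArg (cornerRetraction he _) hy).trans ?_)
  exact cornerRetraction_idemRe he x

end Exactness

/-! ### Exactness under tensoring with a right module of finite projective dimension. -/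

section BalancedTensor

variable {S : Type u} [Ring S]

/-- Dimension shifting uses syzygies of `Re` as a right module, which need not carry a left
`R`-action; `ℤ`, lifted to the universe `u`, takes the place of `R`. -/
instance (B : Type u) [AddCommGroup B] [Module Sᵐᵒᵖ B] :
    SMulCommClass (ULift.{u} ℤ) Sᵐᵒᵖ B where
  smul_comm k s b := smul_comm k.down s b

variable (S) in
/-- The abelian group `B ⊗_S N`, for a right `S`-module `B` and a left `S`-module `N`. -/
abbrev BalTensor (B : Type u) [AddCommGroup B] [Module Sᵐᵒᵖ B] (N : Type u) [AddCommGroup N]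
    [Module S N] : Type u :=
  BimodTensor (ULift.{u} ℤ) S B N

section Maps

variable {B B' B'' : Type u} [AddCommGroup B] [Module Sᵐᵒᵖ B] [AddCommGroup B'] [Module Sᵐᵒᵖ B']
  [AddCommGroup B''] [Module Sᵐᵒᵖ B'']
  {N N' N'' : Type u} [AddCommGroup N] [Module S N] [AddCommGroup N'] [Module S N']
  [AddCommGroup N''] [Module S N'']

/-- The class of `b ⊗ n`. -/
abbrev btmk (b : B) (n : N) : BalTensor S B N := tmk (ULift.{u} ℤ) S b n

/-- The map `B ⊗ f`. -/
noncomputable abbrev rMap (B : Type u) [AddCommGroup B] [Module Sᵐᵒᵖ B] (f : N →ₗ[S] N') :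
    BalTensor S B N →ₗ[ULift.{u} ℤ] BalTensor S B N' :=
  bimodTensorMap (ULift.{u} ℤ) B f

/-- The map `g ⊗ N`. -/
noncomputable def lMap (g : B →ₗ[Sᵐᵒᵖ] B') (N : Type u) [AddCommGroup N] [Module S N] :
    BalTensor S B N →+ BalTensor S B' N :=
  tensorLift _
    { toFun b := tmkHom _ S (g b)
      map_zero' := by
        ext n
        simpa using (tmkHomLeft _ S n).map_zero
      map_add' b b' := by
        ext n
        simp [tmk_add_left] }
    (fun b s n ↦ by simp [tmk_op_smul])

lemma lMap_tmk (g : B →ₗ[Sᵐᵒᵖ] B') (b : B) (n : N) :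
    lMap g N (btmk b n) = btmk (g b) n := rfl

lemma lMap_rMap (g : B →ₗ[Sᵐᵒᵖ] B') (f : N →ₗ[S] N') (x : BalTensor S B N) :
    lMap g N' (rMap B f x) = rMap B' f (lMap g N x) := by
  induction x using tmk_induction with
  | zero => simp
  | tmk b n => rfl
  | add x y hx hy => simp only [map_add, hx, hy]

/-- `B ⊗ N` is a retract of a direct sum of copies of `N`, naturally in `N`, if `B` is
projective. -/
lemma exists_retract_of_projective_left (B : Type u) [AddCommGroup B] [Module Sᵐᵒᵖ B]
    [Module.Projective Sᵐᵒᵖ B] :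
    ∃ (Φ : ∀ (N : Type u) [AddCommGroup N] [Module S N], BalTensor S B N →+ (B →₀ N))
      (Ψ : ∀ (N : Type u) [AddCommGroup N] [Module S N], (B →₀ N) →+ BalTensor S B N),
      (∀ (N : Type u) [AddCommGroup N] [Module S N] (x : BalTensor S B N), Ψ N (Φ N x) = x) ∧
      (∀ (N N' : Type u) [AddCommGroup N] [Module S N] [AddCommGroup N'] [Module S N']
        (f : N →ₗ[S] N') (x : BalTensor S B N) (b : B), Φ N' (rMap B f x) b = f (Φ N x b)) ∧
      (∀ (N N' : Type u) [AddCommGroup N] [Module S N] [AddCommGroup N'] [Module S N']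
        (f : N →ₗ[S] N') (w : B →₀ N),
        Ψ N' (w.mapRange f (map_zero f)) = rMap B f (Ψ N w)) := by
  obtain ⟨s, hs⟩ := Module.projective_def'.1 ‹Module.Projective Sᵐᵒᵖ B›
  let Φ (N : Type u) [AddCommGroup N] [Module S N] : BalTensor S B N →+ (B →₀ N) :=
    tensorLift _
      { toFun b :=
          { toFun n := (s b).mapRange (fun a ↦ a.unop • n) (zero_smul S n)
            map_zero' := by ext; simp
            map_add' n n' := by ext; simp }
        map_zero' := by ext; simp
        map_add' b b' := by ext; simp [add_smul] }
      (fun b a n ↦ by ext; simp [mul_smul])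
  let Ψ (N : Type u) [AddCommGroup N] [Module S N] : (B →₀ N) →+ BalTensor S B N :=
    Finsupp.liftAddHom fun b ↦ tmkHom _ S b
  refine ⟨Φ, Ψ, fun N _ _ x ↦ ?_, fun N N' _ _ _ _ f x b ↦ ?_, fun N N' _ _ _ _ f w ↦ ?_⟩
  · induction x using tmk_induction with
    | zero => simp
    | tmk b n =>
      have h₁ : Φ N (btmk b n) = (s b).mapRange (fun a ↦ a.unop • n) (zero_smul S n) := rfl
      have h₂ : (s b).sum (fun b' a ↦ a • b') = b := LinearMap.congr_fun hs b
      rw [h₁, Finsupp.liftAddHom_apply, Finsupp.sum_mapRange_index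
        fun b' ↦ (tmkHom _ S b').map_zero]
      conv_rhs => rw [← h₂]
      change _ = tmkHomLeft _ S n _
      rw [Finsupp.sum, Finsupp.sum, map_sum]
      exact Finset.sum_congr rfl fun b' _ ↦ (tmk_op_smul ((s b) b').unop b' n).symm
    | add x y hx hy => rw [map_add, map_add, hx, hy]
  · induction x using tmk_induction with
    | zero => simp
    | tmk b' n => exact (map_smul f ((s b') b).unop n).symm
    | add x y hx hy => simp only [map_add, Finsupp.add_apply, hx, hy]
  · induction w using Finsupp.induction_linear with
    | zero => simp
    | add x y hx hy =>
      rw [Finsupp.mapRange_add (fun a b ↦ map_add f a b), map_add, hx, hy, map_add, map_add]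
    | single b n =>
      rw [Finsupp.mapRange_single, Finsupp.liftAddHom_apply_single,
        Finsupp.liftAddHom_apply_single]
      rfl

lemma rMap_exact_of_projective_left (B : Type u) [AddCommGroup B] [Module Sᵐᵒᵖ B]
    [Module.Projective Sᵐᵒᵖ B] {f : N →ₗ[S] N'} {g : N' →ₗ[S] N''}
    (h : ∀ x, g x = 0 → ∃ y, f y = x) (x : BalTensor S B N') (hx : rMap B g x = 0) :
    ∃ y, rMap B f y = x := by
  obtain ⟨Φ, Ψ, h₁, h₂, h₃⟩ := exists_retract_of_projective_left (S := S) B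
  -- Preimages are chosen coordinatewise; `0` must go to `0` for `mapRange` to apply, and outside
  -- the kernel the value is irrelevant.
  have (n : N') : ∃ m : N, (g n = 0 → f m = n) ∧ (n = 0 → m = 0) := by
    by_cases hn : n = 0
    · exact ⟨0, fun _ ↦ by rw [hn, map_zero], fun _ ↦ rfl⟩
    · by_cases hn' : g n = 0
      · obtain ⟨m, hm⟩ := h n hn'
        exact ⟨m, fun _ ↦ hm, fun h' ↦ (hn h').elim⟩
      · exact ⟨0, fun h' ↦ (hn' h').elim, fun _ ↦ rfl⟩
  choose c hc hc₀ using this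
  refine ⟨Ψ N ((Φ N' x).mapRange c (hc₀ 0 rfl)), ?_⟩
  rw [← h₃]
  conv_rhs => rw [← h₁ N' x]
  congr 1
  ext b
  rw [Finsupp.mapRange_apply, Finsupp.mapRange_apply]
  refine hc _ ?_
  rw [← h₂, hx, map_zero, Finsupp.zero_apply]

/-- `B ⊗ N` is a retract of a power of `B`, naturally in `B`, if `N` is finitely generated
projective. -/
lemma exists_retract_of_projective_right (N : Type u) [AddCommGroup N] [Module S N]
    [Module.Finite S N] [Module.Projective S N] :
    ∃ (n : ℕ)
      (Φ : ∀ (B : Type u) [AddCommGroup B] [Module Sᵐᵒᵖ B], BalTensor S B N →+ (Fin n → B))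
      (Ψ : ∀ (B : Type u) [AddCommGroup B] [Module Sᵐᵒᵖ B], (Fin n → B) →+ BalTensor S B N),
      (∀ (B : Type u) [AddCommGroup B] [Module Sᵐᵒᵖ B] (x : BalTensor S B N),
        Ψ B (Φ B x) = x) ∧
      (∀ (B B' : Type u) [AddCommGroup B] [Module Sᵐᵒᵖ B] [AddCommGroup B'] [Module Sᵐᵒᵖ B']
        (g : B →ₗ[Sᵐᵒᵖ] B') (x : BalTensor S B N) (j : Fin n),
        Φ B' (lMap g N x) j = g (Φ B x j)) ∧
      (∀ (B B' : Type u) [AddCommGroup B] [Module Sᵐᵒᵖ B] [AddCommGroup B'] [Module Sᵐᵒᵖ B']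
        (g : B →ₗ[Sᵐᵒᵖ] B') (w : Fin n → B),
        Ψ B' (fun j ↦ g (w j)) = lMap g N (Ψ B w)) := by
  obtain ⟨n, p, q, _, _, hpq⟩ := Module.Finite.exists_comp_eq_id_of_projective S N
  let Φ (B : Type u) [AddCommGroup B] [Module Sᵐᵒᵖ B] : BalTensor S B N →+ (Fin n → B) :=
    tensorLift _
      { toFun b :=
          { toFun m j := MulOpposite.op (q m j) • b
            map_zero' := by ext; simp
            map_add' m m' := by ext; simp [add_smul] }
        map_zero' := by ext; simp
        map_add' b b' := by ext; simp }
      (fun b a n ↦ by ext; simp [mul_smul])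
  let Ψ (B : Type u) [AddCommGroup B] [Module Sᵐᵒᵖ B] : (Fin n → B) →+ BalTensor S B N :=
    { toFun w := ∑ j, btmk (w j) (p (Pi.single j 1))
      map_zero' := Finset.sum_eq_zero fun j _ ↦ (tmkHomLeft _ S _).map_zero
      map_add' v w := by simp [tmk_add_left, Finset.sum_add_distrib] }
  refine ⟨n, Φ, Ψ, fun B _ _ x ↦ ?_, fun B B' _ _ _ _ g x j ↦ ?_, fun B B' _ _ _ _ g w ↦ ?_⟩
  · induction x using tmk_induction with
    | zero => simp
    | tmk b m =>
      change ∑ j, btmk (MulOpposite.op (q m j) • b) (p (Pi.single j 1)) = btmk b m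
      have (j : Fin n) : btmk (MulOpposite.op (q m j) • b) (p (Pi.single j 1)) =
          tmkHom _ S b (p (Pi.single j (q m j) : Fin n → S)) := by
        refine (tmk_op_smul (q m j) b _).trans ?_
        rw [← map_smul, ← Pi.single_smul, smul_eq_mul, mul_one]
        rfl
      rw [Finset.sum_congr rfl fun j _ ↦ this j, ← map_sum, ← map_sum, Finset.univ_sum_single]
      exact congrArg (btmk b) (LinearMap.congr_fun hpq m)
    | add x y hx hy => rw [map_add, map_add, hx, hy]
  · induction x using tmk_induction with
    | zero => simp
    | tmk b m => exact (map_smul g _ b).symm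
    | add x y hx hy => simp only [map_add, Pi.add_apply, hx, hy]
  · change _ = lMap g N (∑ j, btmk (w j) (p (Pi.single j 1)))
    rw [map_sum]
    rfl

variable (N) [Module.Finite S N] [Module.Projective S N]

/-- Tensoring with a finitely generated projective `N` is a natural retract of `B ↦ B^n`; this and
the next two lemmas give its exactness in `B`. -/
lemma lMap_injective {f : B →ₗ[Sᵐᵒᵖ] B'} (hf : Function.Injective f) :
    Function.Injective (lMap f N) := by
  obtain ⟨n, Φ, Ψ, h₁, h₂, h₃⟩ := exists_retract_of_projective_right (S := S) N
  intro x y hxy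
  rw [← h₁ B x, ← h₁ B y]
  congr 1
  ext j
  exact hf (by rw [← h₂, ← h₂, hxy])

lemma lMap_surjective {f : B →ₗ[Sᵐᵒᵖ] B'} (hf : Function.Surjective f) :
    Function.Surjective (lMap f N) := by
  obtain ⟨n, Φ, Ψ, h₁, h₂, h₃⟩ := exists_retract_of_projective_right (S := S) N
  intro x
  choose c hc using hf
  refine ⟨Ψ B fun j ↦ c (Φ B' x j), ?_⟩
  rw [← h₃, ← h₁ B' x]
  congr 1
  ext j
  rw [hc, h₁]

lemma lMap_exact {f : B →ₗ[Sᵐᵒᵖ] B'} {g : B' →ₗ[Sᵐᵒᵖ] B''} (h : ∀ x, g x = 0 → ∃ y, f y = x)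
    (x : BalTensor S B' N) (hx : lMap g N x = 0) : ∃ y, lMap f N y = x := by
  obtain ⟨n, Φ, Ψ, h₁, h₂, h₃⟩ := exists_retract_of_projective_right (S := S) N
  have (j : Fin n) : ∃ y, f y = Φ B' x j :=
    h _ (by rw [← h₂, hx, map_zero, Pi.zero_apply])
  choose c hc using this
  refine ⟨Ψ B c, ?_⟩
  rw [← h₃, funext hc, h₁]

end Maps

/-- Exactness of `B ⊗ K` in degree `j`. -/
def TensorExactAt (B : Type u) [AddCommGroup B] [Module Sᵐᵒᵖ B]
    (K : CochainComplex (ModuleCat.{u} S) ℤ) (j : ℤ) : Prop :=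
  ∀ (i k : ℤ), i + 1 = j → j + 1 = k →
    ∀ x, rMap B (K.d j k).hom x = 0 → ∃ y, rMap B (K.d i j).hom y = x

variable {B B' B'' : Type u} [AddCommGroup B] [Module Sᵐᵒᵖ B] [AddCommGroup B'] [Module Sᵐᵒᵖ B']
  [AddCommGroup B''] [Module Sᵐᵒᵖ B''] {K : CochainComplex (ModuleCat.{u} S) ℤ}

lemma rMap_d_d (B : Type u) [AddCommGroup B] [Module Sᵐᵒᵖ B]
    (K : CochainComplex (ModuleCat.{u} S) ℤ) (i j k : ℤ) (x : BalTensor S B (K.X i)) :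
    rMap B (K.d j k).hom (rMap B (K.d i j).hom x) = 0 := by
  induction x using tmk_induction with
  | zero => simp
  | tmk b n =>
    have : K.d j k (K.d i j n) = 0 := by
      rw [← ModuleCat.comp_apply, K.d_comp_d]
      rfl
    exact (congrArg (tmkHom _ S b) this).trans (map_zero _)
  | add x y hx hy => rw [map_add, map_add, hx, hy, add_zero]

/-- As `K` has finitely generated projective terms, `0 → B' ⊗ K → B ⊗ K → B'' ⊗ K → 0` is exact, and
in its long exact sequence `H^j(B'' ⊗ K)` lies between `H^j(B ⊗ K)` and `H^{j+1}(B' ⊗ K)`. -/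
lemma TensorExactAt.of_shortExact (hK : complexProj S K) {f : B' →ₗ[Sᵐᵒᵖ] B}
    {g : B →ₗ[Sᵐᵒᵖ] B''} (hf : Function.Injective f) (hg : Function.Surjective g)
    (hfg : ∀ x, g x = 0 ↔ ∃ y, f y = x) (j : ℤ) (h : TensorExactAt B K j)
    (h' : TensorExactAt B' K (j + 1)) : TensorExactAt B'' K j := by
  intro i k hij hjk t ht
  have := fun i ↦ (hK i).1
  have := fun i ↦ (hK i).2
  have gf (i : ℤ) (y : BalTensor S B' (K.X i)) : lMap g _ (lMap f _ y) = 0 := by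
    induction y using tmk_induction with
    | zero => simp
    | tmk b n =>
      rw [lMap_tmk, lMap_tmk, (hfg (f b)).2 ⟨b, rfl⟩]
      exact (tmkHomLeft _ S n).map_zero
    | add x y hx hy => rw [map_add, map_add, hx, hy, add_zero]
  obtain ⟨u, rfl⟩ := lMap_surjective _ hg t
  rw [← lMap_rMap] at ht
  obtain ⟨v, hv⟩ := lMap_exact (K.X k) (fun x ↦ (hfg x).1) _ ht
  obtain rfl := hjk
  obtain ⟨w, hw⟩ := h' j (j + 1 + 1) rfl rfl v (lMap_injective (K.X (j + 1 + 1)) hf (by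
    rw [lMap_rMap, hv, rMap_d_d, map_zero]))
  obtain ⟨y, hy⟩ := h i (j + 1) hij rfl (u - lMap f _ w) (by
    rw [map_sub, ← lMap_rMap, hw, hv, sub_self])
  exact ⟨lMap g _ y, by rw [← lMap_rMap, hy, map_sub, gf, sub_zero]⟩

lemma hasProjectiveDimensionLE_ker {T : Type u} [Ring T] {F B : Type u} [AddCommGroup F]
    [Module T F] [AddCommGroup B] [Module T B] [Module.Projective T F] (g : F →ₗ[T] B)
    (hg : Function.Surjective g) (n : ℕ) [h : HasProjectiveDimensionLE (ModuleCat.of T B) (n + 1)] :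
    HasProjectiveDimensionLE (ModuleCat.of T (LinearMap.ker g)) n := by
  let E : ShortComplex (ModuleCat.{u} T) :=
    ShortComplex.mk (X₁ := ModuleCat.of T (LinearMap.ker g)) (X₂ := ModuleCat.of T F)
      (X₃ := ModuleCat.of T B) (ModuleCat.ofHom (LinearMap.ker g).subtype) (ModuleCat.ofHom g) (by
        ext x
        exact x.2)
  have hE : E.ShortExact :=
    { exact := by
        rw [ShortComplex.moduleCat_exact_iff]
        exact fun x hx ↦ ⟨⟨x, hx⟩, rfl⟩
      mono_f := (ModuleCat.mono_iff_injective _).2 Subtype.val_injective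
      epi_g := (ModuleCat.epi_iff_surjective _).2 hg }
  have h₂ : Projective E.X₂ := (IsProjective.iff_projective _).1 ‹_›
  exact (hE.hasProjectiveDimensionLT_X₃_iff n h₂).1 h

/-- If `B` has projective dimension at most `n`, then tensoring with `B` a complex of finitely
generated projective modules shifts the bound below which it is exact by at most `n`. -/
lemma tensorExactAt_of_hasProjectiveDimensionLE (hK : complexProj S K) (b : ℤ)
    (hKb : ∀ j, j < b → K.ExactAt j) (n : ℕ) (B : ModuleCat.{u} Sᵐᵒᵖ)
    [HasProjectiveDimensionLE B n] (j : ℤ) (hj : j < b - n) : TensorExactAt B K j := by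
  have exact_of_projective (B : Type u) [AddCommGroup B] [Module Sᵐᵒᵖ B]
      [Module.Projective Sᵐᵒᵖ B] (j : ℤ) (hj : j < b) : TensorExactAt B K j := by
    intro i k hij hjk x hx
    exact rMap_exact_of_projective_left B
      ((exactAt_iff_moduleCat K i j k hij hjk).1 (hKb j hj)) x hx
  induction n generalizing B j with
  | zero =>
    have : Projective B := (projective_iff_hasProjectiveDimensionLE_zero B).2 ‹_›
    have : Module.Projective Sᵐᵒᵖ B := (IsProjective.iff_projective _).2 this
    exact exact_of_projective B j (by simpa using hj)
  | succ n hn =>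
    -- Cover `B` by a free module: the kernel has dimension at most `n` and is needed in degree `j +
    -- 1 < b - n`.
    let g : (B →₀ Sᵐᵒᵖ) →ₗ[Sᵐᵒᵖ] B := Finsupp.linearCombination Sᵐᵒᵖ id
    have hg : Function.Surjective g := Finsupp.linearCombination_id_surjective Sᵐᵒᵖ B
    have h₁ : HasProjectiveDimensionLE (ModuleCat.of Sᵐᵒᵖ (LinearMap.ker g)) n :=
      hasProjectiveDimensionLE_ker g hg n
    push_cast at hj
    exact TensorExactAt.of_shortExact hK (f := (LinearMap.ker g).subtype) (g := g)
      Subtype.val_injective hg (fun x ↦ ⟨fun hx ↦ ⟨⟨x, hx⟩, rfl⟩, by rintro ⟨y, rfl⟩; exact y.2⟩)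
      j (exact_of_projective _ j (by lia))
      (hn (ModuleCat.of Sᵐᵒᵖ (LinearMap.ker g)) (j + 1) (by lia))

end BalancedTensor

/-! ### Independence of the left action, and preservation of `K^{-,b}`. -/

section Comparison

variable (R S : Type u) [Ring R] [Ring S] (B : Type u) [AddCommGroup B] [Module R B]
  [Module Sᵐᵒᵖ B] [SMulCommClass R Sᵐᵒᵖ B]

/-- The underlying abelian group of `B ⊗_S N` does not depend on the left action on `B`. -/
noncomputable def bimodTensorEquiv (N : Type u) [AddCommGroup N] [Module S N] :
    BimodTensor R S B N ≃+ BalTensor S B N where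
  toFun := tensorLift R ⟨⟨tmkHom _ S, by ext n; exact (tmkHomLeft _ S n).map_zero⟩,
    fun b b' ↦ by ext n; exact tmk_add_left b b' n⟩ fun b s n ↦ tmk_op_smul s b n
  invFun := tensorLift (ULift.{u} ℤ) ⟨⟨tmkHom R S, by ext n; exact (tmkHomLeft _ S n).map_zero⟩,
    fun b b' ↦ by ext n; exact tmk_add_left b b' n⟩ fun b s n ↦ tmk_op_smul s b n
  map_add' := map_add _
  left_inv x := by
    induction x using tmk_induction with
    | zero => simp
    | tmk b n => rfl
    | add x y hx hy => rw [map_add, map_add, hx, hy]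
  right_inv x := by
    induction x using tmk_induction with
    | zero => simp
    | tmk b n => rfl
    | add x y hx hy => rw [map_add, map_add, hx, hy]

variable {R S B} in
lemma bimodTensorEquiv_map {N N' : Type u} [AddCommGroup N] [Module S N] [AddCommGroup N']
    [Module S N'] (f : N →ₗ[S] N') (x : BimodTensor R S B N) :
    bimodTensorEquiv R S B N' (bimodTensorMap R B f x) =
      rMap B f (bimodTensorEquiv R S B N x) := by
  induction x using tmk_induction with
  | zero => simp
  | tmk b n => rfl
  | add x y hx hy => simp only [map_add, hx, hy]

lemma exactAt_of_tensorExactAt (K : CochainComplex (ModuleCat.{u} S) ℤ) (j : ℤ)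
    (h : TensorExactAt B K j) :
    (((tensorFunctor R S B).mapHomologicalComplex (ComplexShape.up ℤ)).obj K).ExactAt j := by
  rw [exactAt_iff_moduleCat _ (j - 1) j (j + 1) (by lia) rfl]
  intro x hx
  have e₁ := bimodTensorEquiv_map (B := B) (R := R) (K.d j (j + 1)).hom x
  obtain ⟨y, hy⟩ := h (j - 1) (j + 1) (by lia) rfl (bimodTensorEquiv R S B _ x)
    (e₁.symm.trans ((congrArg (bimodTensorEquiv R S B _) hx).trans (map_zero _)))
  refine ⟨(bimodTensorEquiv R S B _).symm y, (bimodTensorEquiv R S B _).injective ?_⟩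
  refine (bimodTensorEquiv_map (B := B) (R := R) (K.d (j - 1) j).hom _).trans ?_
  rw [AddEquiv.apply_symm_apply, hy]

end Comparison

open HomologicalComplex CochainComplex Pretriangulated

section Preservation

variable {R : Type u} [Ring R] {e : R} (he : IsIdempotentElem e)

lemma complexProj_iLam {K : CochainComplex (ModuleCat.{u} he.Corner) ℤ}
    (hK : complexProj he.Corner K) :
    complexProj R (((iLam he).mapHomologicalComplex (ComplexShape.up ℤ)).obj K) := fun i ↦ by
  obtain ⟨_, _⟩ := hK i
  exact finite_projective_of_addRe he (addRe_iLam he (K.X i))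

lemma complexBd_iLam {K : CochainComplex (ModuleCat.{u} he.Corner) ℤ}
    (hK : complexBd he.Corner K) :
    complexBd R (((iLam he).mapHomologicalComplex (ComplexShape.up ℤ)).obj K) := by
  obtain ⟨h, ⟨a, ha⟩, ⟨b, hb⟩⟩ := hK
  exact ⟨complexProj_iLam he h, ⟨a, (isStrictlyLE_mapHomologicalComplex_obj_iff ..).2 ha⟩,
    ⟨b, (isStrictlyGE_mapHomologicalComplex_obj_iff ..).2 hb⟩⟩

/-- The finite projective dimension enters here, lowering the cohomological bound from `b` to `b -
n`. -/
lemma complexMb_iLam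
    (hpd : projectiveDimension (ModuleCat.of (he.Corner)ᵐᵒᵖ (LeftRe he)) < ⊤)
    {K : CochainComplex (ModuleCat.{u} he.Corner) ℤ} (hK : complexMb he.Corner K) :
    complexMb R (((iLam he).mapHomologicalComplex (ComplexShape.up ℤ)).obj K) := by
  obtain ⟨h, ⟨a, ha⟩, ⟨b, hb⟩⟩ := hK
  obtain ⟨n, hn⟩ := (projectiveDimension_ne_top_iff _).1 hpd.ne
  refine ⟨complexProj_iLam he h, ⟨a, (isStrictlyLE_mapHomologicalComplex_obj_iff ..).2 ha⟩,
    ⟨b - n, (isGE_iff _ _).2 fun j hj ↦ exactAt_of_tensorExactAt R he.Corner (LeftRe he) K j ?_⟩⟩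
  exact tensorExactAt_of_hasProjectiveDimensionLE h b (fun j hj ↦ K.exactAt_of_isGE b j hj) n
    (ModuleCat.of (he.Corner)ᵐᵒᵖ (LeftRe he)) j hj

end Preservation

/-! ### Von Neumann regular differentials. -/

section Regular

variable {C : Type*} [Category* C] [Abelian C]

/-- If `d h d = d`, the projection of `K.X j` onto the cokernel of `d` splits. -/
noncomputable def retractOpcycles (K : CochainComplex C ℤ) {i j : ℤ} (hij : i + 1 = j)
    (h : K.X j ⟶ K.X i) (hd : K.d i j ≫ h ≫ K.d i j = K.d i j) :
    Retract (K.opcycles j) (K.X j) where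
  i := K.descOpcycles (𝟙 _ - h ≫ K.d i j) i (by simp; lia) (by
    rw [Preadditive.comp_sub, Category.comp_id, hd, sub_self])
  r := K.pOpcycles j
  retract := by
    rw [← cancel_epi (K.pOpcycles j), p_descOpcycles_assoc, Preadditive.sub_comp,
      Category.assoc, K.d_pOpcycles, comp_zero, sub_zero, Category.id_comp, Category.comp_id]

/-- If `d h d = d`, the inclusion of the kernel of `d` in `K.X i` splits. -/
noncomputable def retractCycles (K : CochainComplex C ℤ) {i j : ℤ} (hij : i + 1 = j)
    (h : K.X j ⟶ K.X i) (hd : K.d i j ≫ h ≫ K.d i j = K.d i j) :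
    Retract (K.cycles i) (K.X i) where
  i := K.iCycles i
  r := K.liftCycles (𝟙 _ - K.d i j ≫ h) j (by simp; lia) (by
    rw [Preadditive.sub_comp, Category.id_comp, Category.assoc, hd, sub_self])
  retract := by
    rw [← cancel_mono (K.iCycles i), Category.assoc, liftCycles_i, Preadditive.comp_sub,
      K.iCycles_d_assoc, zero_comp, sub_zero, Category.id_comp, Category.comp_id]

/-- The differential leaving a degree in which the identity is homotopic to a map factoring
through zero is von Neumann regular. -/
lemma exists_regular_of_isZero_left {K B : CochainComplex C ℤ} (f : K ⟶ B) (g : B ⟶ K)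
    (H : Homotopy (f ≫ g) (𝟙 K)) {i j : ℤ} (hij : i + 1 = j) (hB : IsZero (B.X i)) :
    ∃ h : K.X j ⟶ K.X i, K.d i j ≫ h ≫ K.d i j = K.d i j := by
  have hc := H.comm i
  rw [dNext_eq _ (show (ComplexShape.up ℤ).Rel i j from hij),
    prevD_eq _ (show (ComplexShape.up ℤ).Rel (i - 1) i by simp), comp_f,
    hB.eq_of_tgt (f.f i) 0, zero_comp, id_f] at hc
  have hc' := congrArg (· ≫ K.d i j) hc
  simp only [zero_comp, Preadditive.add_comp, Category.assoc, K.d_comp_d, comp_zero, add_zero,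
    Category.id_comp] at hc'
  -- In this degree the homotopy relation reads `0 = d h + h d + 1`, so `d h d = -d`; hence the
  -- sign.
  refine ⟨-H.hom j i, ?_⟩
  rw [Preadditive.neg_comp, Preadditive.comp_neg, neg_eq_iff_add_eq_zero, hc']

/-- The differential arriving in a degree in which the identity is homotopic to a map factoring
through zero is von Neumann regular. -/
lemma exists_regular_of_isZero_right {K B : CochainComplex C ℤ} (f : K ⟶ B) (g : B ⟶ K)
    (H : Homotopy (f ≫ g) (𝟙 K)) {i j : ℤ} (hij : i + 1 = j) (hB : IsZero (B.X j)) :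
    ∃ h : K.X j ⟶ K.X i, K.d i j ≫ h ≫ K.d i j = K.d i j := by
  have hc := H.comm j
  rw [dNext_eq _ (show (ComplexShape.up ℤ).Rel j (j + 1) by simp),
    prevD_eq _ (show (ComplexShape.up ℤ).Rel i j from hij), comp_f,
    hB.eq_of_tgt (f.f j) 0, zero_comp, id_f] at hc
  have hc' := congrArg (K.d i j ≫ ·) hc
  simp only [comp_zero, Preadditive.comp_add, K.d_comp_d_assoc, zero_comp, zero_add,
    Category.comp_id] at hc'
  refine ⟨-H.hom j i, ?_⟩
  rw [Preadditive.neg_comp, Preadditive.comp_neg, neg_eq_iff_add_eq_zero, hc']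

end Regular

/-! ### Perfect complexes form a thick subcategory. -/

section Perfect

variable {R : Type u} [Ring R]

lemma complexProj.projective {K : CochainComplex (ModuleCat.{u} R) ℤ} (hK : complexProj R K)
    (i : ℤ) : Projective (K.X i) :=
  (IsProjective.iff_projective _).1 (hK i).2

lemma finite_projective_of_iso {M N : ModuleCat.{u} R} (φ : M ≅ N)
    (h : Module.Finite R N ∧ Module.Projective R N) :
    Module.Finite R M ∧ Module.Projective R M :=
  finite_projective_of_retract (Retract.ofIso φ) h

lemma finite_projective_of_isZero {M : ModuleCat.{u} R} (h : IsZero M) :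
    Module.Finite R M ∧ Module.Projective R M := by
  have : Subsingleton M := ModuleCat.subsingleton_of_isZero h
  exact ⟨inferInstance, Module.Projective.of_free⟩

/-- Quasi-isomorphic bounded above complexes of projectives are isomorphic in the homotopy
category. -/
lemma isIso_quotient_map_of_quasiIso {K L : CochainComplex (ModuleCat.{u} R) ℤ}
    (hK : complexProj R K) (hL : complexProj R L) (a b : ℤ) [K.IsStrictlyLE a]
    [L.IsStrictlyLE b] (f : K ⟶ L) [QuasiIso f] :
    IsIso ((HomotopyCategory.quotient _ (ComplexShape.up ℤ)).map f) := by
  have := hK.projective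
  have := hL.projective
  have := isKProjective_of_projective K a
  have := isKProjective_of_projective L b
  rw [HomologicalComplex.isIso_quotient_map_iff_homotopyEquivalences]
  exact (IsKProjective.quasiIso_iff f).1 inferInstance

/-- The canonical truncation of `K` in degrees `≥ j` is quasi-isomorphic to `K`. Its lowest term is
a cokernel, which regularity makes a summand of `K.X j`, so all its terms are projective and the
quasi-isomorphism is a homotopy equivalence. -/
lemma perfect_of_regular {K : CochainComplex (ModuleCat.{u} R) ℤ} (hK : complexMb R K)
    (i j : ℤ) (hij : i + 1 = j) (hj : K.IsGE j) (h : K.X j ⟶ K.X i)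
    (hd : K.d i j ≫ h ≫ K.d i j = K.d i j) :
    (Kbd R).isoClosure ((HomotopyCategory.quotient _ (ComplexShape.up ℤ)).obj K) := by
  obtain ⟨hp, ⟨a, ha⟩, _⟩ := hK
  have hT : complexProj R (K.truncGE j) := fun k ↦ by
    obtain hk | rfl | hk := lt_trichotomy k j
    · exact finite_projective_of_isZero ((K.truncGE j).isZero_of_isStrictlyGE j k hk)
    · exact finite_projective_of_iso (K.truncGEXIsoOpcycles k)
        (finite_projective_of_retract (retractOpcycles K hij h hd) (hp k))
    · exact finite_projective_of_iso (K.truncGEXIso j k hk) (hp k)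
  have hLE : (K.truncGE j).IsStrictlyLE a := inferInstance
  have hGE : (K.truncGE j).IsStrictlyGE j := inferInstance
  have := isIso_quotient_map_of_quasiIso hp hT a a (K.πTruncGE j)
  exact ⟨(HomotopyCategory.quotient _ _).obj (K.truncGE j),
    ⟨hT, ⟨a, hLE⟩, ⟨j, hGE⟩⟩,
    ⟨asIso ((HomotopyCategory.quotient _ _).map (K.πTruncGE j))⟩⟩

lemma perfect_of_retract (X : KmbCat R)
    (B : HomotopyCategory (ModuleCat.{u} R) (ComplexShape.up ℤ)) (hB : Kbd R B)
    (r : Retract X.obj B) : perfect R X := by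
  obtain ⟨⟨K : CochainComplex (ModuleCat.{u} R) ℤ⟩, hX⟩ := X
  obtain ⟨B : CochainComplex (ModuleCat.{u} R) ℤ⟩ := B
  obtain ⟨f : K ⟶ B, hf⟩ := (HomotopyCategory.quotient _ _).map_surjective r.i
  obtain ⟨g : B ⟶ K, hg⟩ := (HomotopyCategory.quotient _ _).map_surjective r.r
  have H : Homotopy (f ≫ g) (𝟙 K) := HomotopyCategory.homotopyOfEq _ _ (by
    rw [Functor.map_comp, hf, hg, CategoryTheory.Functor.map_id]
    exact r.retract)
  obtain ⟨_, _, ⟨k, hk⟩⟩ := hB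
  obtain ⟨n, hn⟩ := hX.2.2
  -- In this degree `B` vanishes, and `K` is exact in all degrees up to and including it.
  obtain ⟨h, hd⟩ := exists_regular_of_isZero_left f g H (i := min (k - 1) (n - 1)) rfl
    (B.isZero_of_isStrictlyGE k _ (by simp))
  exact perfect_of_regular hX _ _ rfl (K.isGE_of_ge _ n (by lia)) h hd

/-- The identity of `X` is killed by a denominator, so it factors through the perfect fibre of that
denominator, of which `X` is a retract. -/
lemma perfect_of_isZero_quot (X : KmbCat R) (hX : IsZero ((quot R).obj X)) : perfect R X := by
  have h : (quot R).map (𝟙 X) = (quot R).map 0 := hX.eq_of_src _ _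
  rw [MorphismProperty.map_eq_iff_postcomp (quot R) (perfect R).trW] at h
  obtain ⟨Z, s, hs, hs'⟩ := h
  rw [ObjectProperty.trW_iff'] at hs
  obtain ⟨W, f, g, hT, B, hB, ⟨φ⟩⟩ := hs
  obtain ⟨i, hi⟩ := Triangle.coyoneda_exact₂ _ hT (𝟙 X) (by
    change 𝟙 X ≫ s = 0
    rw [hs', zero_comp])
  have hi' : 𝟙 X = i ≫ f := hi
  let r : Retract X W := ⟨i, f, hi'.symm⟩
  exact perfect_of_retract X B hB ((r.map (Kmb R).ι).trans (Retract.ofIso φ))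

/-- A triangulated subcategory of `K^{-,b}(proj R)` which contains the perfect complexes is
closed under isomorphisms in the singularity category. -/
lemma prop_of_quot_iso (P : ObjectProperty (KmbCat R)) [P.IsTriangulated]
    [P.IsClosedUnderIsomorphisms] (hP : perfect R ≤ P) {X Y : KmbCat R}
    (φ : (quot R).obj X ≅ (quot R).obj Y) (hY : P Y) : P X := by
  obtain ⟨f, hf⟩ := Localization.exists_leftFraction (quot R) (perfect R).trW φ.hom
  have hs := Localization.inverts (quot R) _ _ f.hs
  have hfi : IsIso ((quot R).map f.f) := by
    have : (quot R).map f.f = φ.hom ≫ (quot R).map f.s := by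
      rw [hf, MorphismProperty.LeftFraction.map_comp_map_s]
    rw [this]
    infer_instance
  obtain ⟨Z, a, b, hT, hZ⟩ := f.hs
  have hY' : P f.Y' := P.ext_of_isTriangulatedClosed₂ _ hT hY (hP _ hZ)
  -- The numerator becomes invertible in the quotient, so its cone becomes zero there and is perfect
  -- by thickness.
  obtain ⟨N, c, d, hT'⟩ := distinguished_cocone_triangle f.f
  have hN : perfect R N := perfect_of_isZero_quot N
    (Triangle.isZero₃_of_isIso₁ _ ((quot R).map_distinguished _ hT') hfi)
  exact P.ext_of_isTriangulatedClosed₁ _ hT' hY' (hP _ hN)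

end Perfect

/-! ### The factorization property for `i_λ`. -/

section Induced

variable {R : Type u} [Ring R] {e : R} (he : IsIdempotentElem e)
  (h : ∀ X, Kmb he.Corner X → Kmb R (((iLam he).mapHomotopyCategory (ComplexShape.up ℤ)).obj X))

lemma perfect_iLamKmb : perfect he.Corner ≤ (perfect R).inverseImage (iLamKmb he h) := by
  rintro X ⟨B, hB, ⟨φ⟩⟩
  exact ⟨_, complexBd_iLam he hB, ⟨((iLam he).mapHomotopyCategory (ComplexShape.up ℤ)).mapIso φ⟩⟩

/-- A chain map from a complex in degrees `≥ k` lifts to the brutal truncation of its target. That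
of `i_λ K` is `i_λ` of the truncation of `K`, which is bounded since `K` is bounded above. -/
lemma exists_factorization_iLamKmb {W : KmbCat R} {Y : KmbCat he.Corner}
    (f : W ⟶ (iLamKmb he h).obj Y) (hW : perfect R W) :
    ∃ (Z : KmbCat he.Corner) (a : W ⟶ (iLamKmb he h).obj Z) (b : Z ⟶ Y),
      perfect he.Corner Z ∧ a ≫ (iLamKmb he h).map b = f := by
  obtain ⟨B, hB, ⟨φ⟩⟩ := hW
  obtain ⟨B : CochainComplex (ModuleCat.{u} R) ℤ⟩ := B
  obtain ⟨⟨K : CochainComplex (ModuleCat.{u} he.Corner) ℤ⟩, hK⟩ := Y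
  let G := (iLam he).mapHomologicalComplex (ComplexShape.up ℤ)
  obtain ⟨g : B ⟶ G.obj K, hg⟩ := (HomotopyCategory.quotient _ _).map_surjective (φ.inv ≫ f.hom)
  obtain ⟨_, _, ⟨k, hk⟩⟩ := hB
  obtain ⟨T, ι, hι, hT⟩ := exists_brutalGE K k
  obtain ⟨g', hg'⟩ := exists_lift_of_isIso_f (G.map ι) k
    (fun i hi ↦ by
      have := hι i hi
      exact inferInstanceAs (IsIso ((iLam he).map (ι.f i))))
    (fun i hi ↦ B.isZero_of_isStrictlyGE k i hi) g
  have hTb : complexBd he.Corner T := by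
    obtain ⟨hp, ⟨a, ha⟩, _⟩ := hK
    refine ⟨fun i ↦ ?_, ⟨a, (isStrictlyLE_iff _ _).2 fun i hi ↦ ?_⟩,
      ⟨k, (isStrictlyGE_iff _ _).2 hT⟩⟩
    · obtain hi | hi := lt_or_ge i k
      · exact finite_projective_of_isZero (hT i hi)
      · have := hι i hi
        exact finite_projective_of_iso (asIso (ι.f i)) (hp i)
    · obtain hi' | hi' := lt_or_ge i k
      · exact hT i hi'
      · have := hι i hi'
        exact (K.isZero_of_isStrictlyLE a i hi).of_iso (asIso (ι.f i))
  obtain ⟨hT₁, hT₂, ⟨b, hb⟩⟩ := id hTb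
  have hGE : T.IsGE b := inferInstance
  refine ⟨⟨(HomotopyCategory.quotient _ _).obj T, hT₁, hT₂, ⟨b, hGE⟩⟩,
    (Kmb R).homMk (φ.hom ≫ (HomotopyCategory.quotient _ _).map g'),
    (Kmb he.Corner).homMk ((HomotopyCategory.quotient _ _).map ι),
    ⟨_, hTb, ⟨Iso.refl _⟩⟩, ?_⟩
  have : (HomotopyCategory.quotient _ (ComplexShape.up ℤ)).map g' ≫
      (HomotopyCategory.quotient _ _).map (G.map ι) = φ.inv ≫ f.hom :=
    (Functor.map_comp _ _ _).symm.trans ((congrArg _ hg').trans hg)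
  refine ObjectProperty.hom_ext _ ((Category.assoc _ _ _).trans
    ((congrArg (φ.hom ≫ ·) this).trans ?_))
  exact φ.hom_inv_id_assoc _

lemma kmb_iLam (hpd : projectiveDimension (ModuleCat.of (he.Corner)ᵐᵒᵖ (LeftRe he)) < ⊤)
    (X : HomotopyCategory (ModuleCat.{u} he.Corner) (ComplexShape.up ℤ)) (hX : Kmb he.Corner X) :
    Kmb R (((iLam he).mapHomotopyCategory (ComplexShape.up ℤ)).obj X) :=
  complexMb_iLam he hpd hX

end Induced

/-! ### Comparison of complexes up to quasi-isomorphism. -/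

section Abelian

variable {C : Type*} [Category* C] [Abelian C]

lemma quasiIsoAt_of_isIso_f {K L : CochainComplex C ℤ} (φ : K ⟶ L) (j : ℤ)
    [IsIso (φ.f (j - 1))] [IsIso (φ.f j)] [IsIso (φ.f (j + 1))] : QuasiIsoAt φ j := by
  rw [quasiIsoAt_iff' φ (j - 1) j (j + 1) (by simp) (by simp)]
  let ψ := (shortComplexFunctor' C (ComplexShape.up ℤ) (j - 1) j (j + 1)).map φ
  have : IsIso ψ.τ₁ := inferInstanceAs (IsIso (φ.f (j - 1)))
  have : IsIso ψ.τ₂ := inferInstanceAs (IsIso (φ.f j))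
  have : IsIso ψ.τ₃ := inferInstanceAs (IsIso (φ.f (j + 1)))
  exact ShortComplex.quasiIso_of_epi_of_isIso_of_mono ψ

/-- Cohomology in degree `j` involves degrees up to `j + 1`, and `j < c ≤ k` keeps these in the
range of agreement. -/
lemma isGE_of_isIso_f {K T : CochainComplex C ℤ} (π : K ⟶ T) (k : ℤ)
    (hπ : ∀ i, i ≤ k → IsIso (π.f i)) (c : ℤ) (hc : c ≤ k) [K.IsGE c] : T.IsGE c := by
  rw [isGE_iff]
  intro j hj
  have := hπ (j - 1) (by lia)
  have := hπ j (by lia)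
  have := hπ (j + 1) (by lia)
  have := quasiIsoAt_of_isIso_f π j
  rw [← exactAt_iff_of_quasiIsoAt π]
  exact K.exactAt_of_isGE c j hj

/-- Maps out of a K-projective complex are the same in the homotopy and derived categories. -/
lemma nonempty_quotient_iso_of_Q_iso [HasDerivedCategory C] {K L : CochainComplex C ℤ}
    [K.IsKProjective] [L.IsKProjective] (φ : DerivedCategory.Q.obj K ≅ DerivedCategory.Q.obj L) :
    Nonempty ((HomotopyCategory.quotient C (ComplexShape.up ℤ)).obj K ≅
      (HomotopyCategory.quotient C (ComplexShape.up ℤ)).obj L) := by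
  let e := DerivedCategory.quotientCompQhIso C
  let ψ : DerivedCategory.Qh.obj ((HomotopyCategory.quotient C (ComplexShape.up ℤ)).obj K) ≅
    DerivedCategory.Qh.obj ((HomotopyCategory.quotient C (ComplexShape.up ℤ)).obj L) :=
    e.app K ≪≫ φ ≪≫ (e.app L).symm
  obtain ⟨f, hf⟩ := (IsKProjective.Qh_map_bijective K _).2 ψ.hom
  obtain ⟨g, hg⟩ := (IsKProjective.Qh_map_bijective L _).2 ψ.inv
  exact ⟨f, g, (IsKProjective.Qh_map_bijective K _).1 (by simp [hf, hg]),
    (IsKProjective.Qh_map_bijective L _).1 (by simp [hf, hg])⟩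

end Abelian

/-! ### Essential surjectivity from resolutions. -/

section EssSurj

variable {R : Type u} [Ring R]

/-- The object of `K^{-,b}(proj R)` given by a complex. -/
def toKmb {K : CochainComplex (ModuleCat.{u} R) ℤ} (hK : complexMb R K) : KmbCat R :=
  ⟨(HomotopyCategory.quotient _ _).obj K, hK⟩

lemma complexProj.isKProjective {K : CochainComplex (ModuleCat.{u} R) ℤ} (hK : complexProj R K)
    (a : ℤ) [K.IsStrictlyLE a] : K.IsKProjective := by
  have := hK.projective
  exact isKProjective_of_projective K a

/-- In the singularity category, a complex is isomorphic to its brutal truncations. -/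
lemma exists_brutalLE_quot_iso {K : CochainComplex (ModuleCat.{u} R) ℤ} (hK : complexMb R K)
    (k : ℤ) : ∃ (T : CochainComplex (ModuleCat.{u} R) ℤ) (π : K ⟶ T) (hT : complexMb R T),
      (∀ i, i ≤ k → IsIso (π.f i)) ∧ (∀ i, k < i → IsZero (T.X i)) ∧
      Nonempty ((quot R).obj (toKmb hK) ≅ (quot R).obj (toKmb hT)) := by
  obtain ⟨T, π, hπ, hT⟩ := exists_brutalLE K k
  obtain ⟨U, ι, hι, hU⟩ := exists_brutalGE K (k + 1)
  obtain ⟨δ, hδ⟩ := exists_distinguished_of_brutal ι π k (fun i hi ↦ hι i (by lia))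
    (fun i hi ↦ hU i (by lia)) hπ hT
  obtain ⟨hp, ⟨a, ha⟩, ⟨b, hb⟩⟩ := id hK
  have hTM : complexMb R T := by
    refine ⟨fun i ↦ ?_, ⟨k, (isStrictlyLE_iff _ _).2 hT⟩, ⟨min b k, ?_⟩⟩
    · obtain hi | hi := le_or_gt i k
      · have := hπ i hi
        exact finite_projective_of_iso (asIso (π.f i)).symm (hp i)
      · exact finite_projective_of_isZero (hT i hi)
    · have := K.isGE_of_ge (min b k) b (by simp)
      exact isGE_of_isIso_f π k hπ _ (by simp)
  have hUB : complexBd R U := by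
    refine ⟨fun i ↦ ?_, ⟨a, (isStrictlyLE_iff _ _).2 fun i hi ↦ ?_⟩,
      ⟨k + 1, (isStrictlyGE_iff _ _).2 hU⟩⟩
    · obtain hi | hi := lt_or_ge i (k + 1)
      · exact finite_projective_of_isZero (hU i hi)
      · have := hι i hi
        exact finite_projective_of_iso (asIso (ι.f i)) (hp i)
    · obtain hi' | hi' := lt_or_ge i (k + 1)
      · exact hU i hi'
      · have := hι i hi'
        exact (K.isZero_of_isStrictlyLE a i hi).of_iso (asIso (ι.f i))
  let p : toKmb hK ⟶ toKmb hTM := (Kmb R).homMk ((HomotopyCategory.quotient _ _).map π)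
  have hp : (perfect R).trW p := by
    -- The fibre of `π` is the complementary truncation `U`, a bounded complex.
    rw [ObjectProperty.inverseImage_trW_iff, ObjectProperty.trW_iff']
    exact ⟨_, _, _, hδ, (HomotopyCategory.quotient _ _).obj U, hUB, ⟨Iso.refl _⟩⟩
  have := Localization.inverts (quot R) _ _ hp
  exact ⟨T, π, hTM, hπ, hT, ⟨asIso ((quot R).map p)⟩⟩

/-- A complex concentrated in nonpositive degrees and exact in negative degrees resolves a
finitely generated module. -/
lemma exists_quasiIso_single {S : CochainComplex (ModuleCat.{u} R) ℤ} (hS : complexProj R S)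
    [S.IsStrictlyLE 0] [S.IsGE 0] :
    ∃ (M : ModuleCat.{u} R) (p : S ⟶ (singleFunctor _ 0).obj M), Module.Finite R M ∧
      QuasiIso p := by
  obtain ⟨M, ⟨φ⟩⟩ := (S.truncGE 0).exists_iso_single 0
  let φ : S.truncGE 0 ≅ (singleFunctor _ 0).obj M := φ
  refine ⟨M, S.πTruncGE 0 ≫ φ.hom, ?_, quasiIso_comp _ _⟩
  let ψ : S.opcycles 0 ≅ M := (S.truncGEXIsoOpcycles 0).symm ≪≫
    (HomologicalComplex.eval _ _ 0).mapIso φ ≪≫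
    singleObjXSelf (ComplexShape.up ℤ) 0 M
  have := (hS 0).1
  have hs : Function.Surjective (S.pOpcycles 0 ≫ ψ.hom).hom :=
    (ModuleCat.epi_iff_surjective _).1 inferInstance
  exact Module.Finite.of_surjective _ hs

attribute [local instance] HasDerivedCategory.standard in
lemma nonempty_quotient_iso_of_single {S T : CochainComplex (ModuleCat.{u} R) ℤ}
    [S.IsKProjective] [T.IsKProjective] {M : ModuleCat.{u} R}
    (p : S ⟶ (singleFunctor _ 0).obj M) (q : T ⟶ (singleFunctor _ 0).obj M) [QuasiIso p]
    [QuasiIso q] : Nonempty ((HomotopyCategory.quotient _ (ComplexShape.up ℤ)).obj S ≅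
      (HomotopyCategory.quotient _ (ComplexShape.up ℤ)).obj T) :=
  nonempty_quotient_iso_of_Q_iso
    (asIso (DerivedCategory.Q.map p) ≪≫ (asIso (DerivedCategory.Q.map q)).symm)

lemma complexMb_cochainComplex {M : ModuleCat.{u} R} (P : ProjectiveResolution M)
    (hP : ∀ i : ℕ, Module.Finite R (P.complex.X i)) : complexMb R P.cochainComplex := by
  refine ⟨fun i ↦ ?_, ⟨0, inferInstance⟩, ⟨0, inferInstance⟩⟩
  obtain hi | hi := le_or_gt i 0
  · obtain ⟨k, rfl⟩ := Int.exists_eq_neg_ofNat hi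
    exact finite_projective_of_iso (P.cochainComplexXIso (-k) k)
      ⟨hP k, (IsProjective.iff_projective _).2 (P.projective k)⟩
  · exact finite_projective_of_isZero (P.cochainComplex.isZero_of_isStrictlyLE 0 i hi)

set_option synthInstance.maxSize 1000 in
lemma isTriangulated_essImage {S : Type u} [Ring S] (F : DSg S ⥤ DSg R) [F.CommShift ℤ]
    [F.IsTriangulated] [F.Full] : F.essImage.IsTriangulated :=
  inferInstance

variable {e : R} (he : IsIdempotentElem e)
  (h : ∀ X, Kmb he.Corner X → Kmb R (((iLam he).mapHomotopyCategory (ComplexShape.up ℤ)).obj X))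
  (F : DSg he.Corner ⥤ DSg R) (α : quot he.Corner ⋙ F ≅ iLamKmb he h ⋙ quot R)

include α in
-- The complex lifts termwise to `proj eRe`, and the lift has bounded cohomology because `i_λ`
-- reflects exactness.
lemma essImage_of_addRe {T : CochainComplex (ModuleCat.{u} R) ℤ} (hT : complexMb R T)
    (hT' : ∀ i, addRe he (T.X i)) : F.essImage ((quot R).obj (toKmb hT)) := by
  obtain ⟨Y, hY, ⟨φ⟩⟩ := exists_mapHomologicalComplex_iso (iLam he)
    (fun N ↦ Module.Finite he.Corner N ∧ Module.Projective he.Corner N) T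
    (fun i ↦ exists_iLam_iso he (hT' i))
  obtain ⟨_, ⟨a, ha⟩, ⟨b, hb⟩⟩ := id hT
  have hYM : complexMb he.Corner Y := by
    refine ⟨hY, ⟨a, ?_⟩, ⟨b, ?_⟩⟩
    · rw [← isStrictlyLE_mapHomologicalComplex_obj_iff Y (iLam he)]
      exact isStrictlyLE_of_iso φ.symm a
    · rw [isGE_iff]
      have := isGE_of_iso φ.symm b
      exact fun j hj ↦ exactAt_of_iLam he Y j (exactAt_of_isGE _ b j hj)
  let ψ : (iLamKmb he h).obj (toKmb hYM) ≅ toKmb hT :=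
    (Kmb R).isoMk ((HomotopyCategory.quotient _ (ComplexShape.up ℤ)).mapIso φ)
  exact ⟨(quot he.Corner).obj (toKmb hYM), ⟨α.app _ ≪≫ (quot R).mapIso ψ⟩⟩

include α in
-- After a shift and a brutal truncation, the complex resolves a finitely generated module `M`. It
-- is then homotopy equivalent to the given resolution of `M`, and a second truncation leaves only
-- terms in `add Re`.
lemma essSurj_of_resolutions [F.CommShift ℤ] [F.IsTriangulated] [F.Full]
    (hres : ∀ (M : ModuleCat.{u} R), Module.Finite R M →
      ∃ (l : ℤ) (P : ProjectiveResolution M), (∀ i : ℕ, Module.Finite R (P.complex.X i)) ∧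
        ∀ i : ℕ, l ≤ i → addRe he (P.complex.X i)) : F.EssSurj := by
  have : (quot R).EssSurj := Localization.essSurj (quot R) (perfect R).trW
  suffices key : ∀ X : KmbCat R, F.essImage ((quot R).obj X) from
    ⟨fun Y ↦ F.essImage.prop_of_iso ((quot R).objObjPreimageIso Y) (key _)⟩
  have key' {K : CochainComplex (ModuleCat.{u} R) ℤ} (hK : complexMb R K) (hK' : K.IsGE 0) :
      F.essImage ((quot R).obj (toKmb hK)) := by
    obtain ⟨S, π, hS, hπ, hS', ⟨φ⟩⟩ := exists_brutalLE_quot_iso hK 0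
    have := (isStrictlyLE_iff S 0).2 hS'
    have := isGE_of_isIso_f π 0 hπ 0 le_rfl
    obtain ⟨M, p, hM, hp⟩ := exists_quasiIso_single hS.1
    obtain ⟨l, P, hP, hP'⟩ := hres M hM
    have hPM := complexMb_cochainComplex P hP
    have := hS.1.isKProjective 0
    have := hPM.1.isKProjective 0
    obtain ⟨ψ⟩ := nonempty_quotient_iso_of_single p P.π'
    let ψ' : toKmb hS ≅ toKmb hPM := (Kmb R).isoMk ψ
    -- Index `k ≥ l` of the resolution is cohomological degree `-k ≤ -l`.
    obtain ⟨T, ρ, hT, hρ, hT', ⟨χ⟩⟩ := exists_brutalLE_quot_iso hPM (min (-l) 0)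
    refine F.essImage.prop_of_iso (φ ≪≫ (quot R).mapIso ψ' ≪≫ χ).symm
      (essImage_of_addRe he h F α hT fun i ↦ ?_)
    obtain hi | hi := le_or_gt i (min (-l) 0)
    · have := hρ i hi
      obtain ⟨k, rfl⟩ := Int.exists_eq_neg_ofNat (hi.trans (by simp))
      exact addRe_of_retract he
        (Retract.ofIso ((asIso (ρ.f (-k))).symm ≪≫ P.cochainComplexXIso (-k) k)) (hP' k (by lia))
    · exact addRe_of_isZero he (hT' i hi)
  intro X
  obtain ⟨⟨K : CochainComplex (ModuleCat.{u} R) ℤ⟩, hX⟩ := X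
  obtain ⟨h₁, ⟨a, _⟩, ⟨b, _⟩⟩ := id hX
  have hGE : (K⟦b⟧).IsGE 0 := K.isGE_shift b b 0 (by lia)
  have hK : complexMb R (K⟦b⟧) := ⟨fun i ↦ h₁ (i + b), ⟨a - b, K.isStrictlyLE_shift a b (a - b)
    (by lia)⟩, ⟨0, hGE⟩⟩
  let φ : (toKmb (K := K) hX)⟦b⟧ ≅ toKmb hK := (Kmb R).isoMk
    (((Kmb R).ι.commShiftIso b).app (toKmb (K := K) hX) ≪≫
      ((HomotopyCategory.quotient _ (ComplexShape.up ℤ)).commShiftIso b).symm.app K)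
  -- The essential image is closed under shifts, so the case of `K⟦b⟧`, exact in negative degrees,
  -- suffices.
  have := isTriangulated_essImage F
  refine (F.essImage.prop_shift_iff_of_isStableUnderShift _ b).1 ?_
  exact F.essImage.prop_of_iso
    (((quot R).commShiftIso b).app (toKmb (K := K) hX)) (F.essImage.prop_of_iso
      ((quot R).mapIso φ).symm (key' hK hGE))

end EssSurj

/-! ### Resolutions by finitely generated projectives. -/

section Resolution

variable {R : Type u} [Ring R]

lemma exists_free_epi_fgModuleCat [IsNoetherianRing R] (M : FGModuleCat.{u} R) :
    ∃ (n : ℕ) (f : FGModuleCat.of R (Fin n → R) ⟶ M), Projective (FGModuleCat.of R (Fin n → R)) ∧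
      Epi f := by
  obtain ⟨n, f, hf⟩ := Module.Finite.exists_fin' R M
  refine ⟨n, FGModuleCat.ofHom f, ?_, ?_⟩
  · have : Projective ((forget₂ (FGModuleCat.{u} R) (ModuleCat.{u} R)).obj
        (FGModuleCat.of R (Fin n → R))) :=
      (IsProjective.iff_projective (R := R) (Fin n → R)).1 inferInstance
    exact (forget₂ (FGModuleCat.{u} R) (ModuleCat.{u} R)).projective_of_map_projective this
  · apply (forget₂ (FGModuleCat.{u} R) (ModuleCat.{u} R)).epi_of_epi_map
    exact (ModuleCat.epi_iff_surjective _).2 hf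

instance [IsNoetherianRing R] : EnoughProjectives (FGModuleCat.{u} R) where
  presentation M := by
    obtain ⟨n, f, h₁, h₂⟩ := exists_free_epi_fgModuleCat M
    exact ⟨{ p := _, projective := h₁, f := f, epi := h₂ }⟩

/-- A projective object among finitely generated modules is a summand of a finite free module, hence
projective among all modules. -/
instance [IsNoetherianRing R] :
    (forget₂ (FGModuleCat.{u} R) (ModuleCat.{u} R)).PreservesProjectiveObjects where
  projective_obj {P} hP := by
    obtain ⟨n, f, h₁, h₂⟩ := exists_free_epi_fgModuleCat P
    let r : Retract P (FGModuleCat.of R (Fin n → R)) :=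
      ⟨Projective.factorThru (𝟙 P) f, f, Projective.factorThru_comp _ _⟩
    refine (IsProjective.iff_projective _).1 (finite_projective_of_retract
      (r.map (forget₂ (FGModuleCat.{u} R) (ModuleCat.{u} R))) ?_).2
    exact ⟨inferInstanceAs (Module.Finite R (Fin n → R)),
      inferInstanceAs (Module.Projective R (Fin n → R))⟩

instance : (forget₂ (FGModuleCat.{u} R) (ModuleCat.{u} R)).Additive where
  map_add := rfl

/-- Over a noetherian ring, finitely generated modules have projective resolutions by finitely
generated modules. -/
lemma exists_finite_projectiveResolution [IsNoetherianRing R] (M : ModuleCat.{u} R)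
    (hM : Module.Finite R M) :
    ∃ P : ProjectiveResolution M, ∀ i : ℕ, Module.Finite R (P.complex.X i) := by
  let P := ProjectiveResolution.of (C := FGModuleCat.{u} R) ⟨M, hM⟩
  exact ⟨(forget₂ (FGModuleCat.{u} R) (ModuleCat.{u} R)).mapProjectiveResolution P,
    fun i ↦ (P.complex.X i).property⟩

end Resolution

/-! ### Complexes with terms eventually in `add Re`. -/

section Eventually

variable {R : Type u} [Ring R] {e : R} (he : IsIdempotentElem e)

/-- The complexes in `K^{-,b}(proj R)` whose terms in sufficiently negative degrees belong to
`add Re`. -/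
def eventuallyAddRe : ObjectProperty (CochainComplex (ModuleCat.{u} R) ℤ) :=
  fun K ↦ complexMb R K ∧ ∃ l, ∀ i, i ≤ l → addRe he (K.X i)

instance isTriangulated_eventuallyAddRe : ObjectProperty.IsTriangulated
    (fun X : HomotopyCategory (ModuleCat.{u} R) (ComplexShape.up ℤ) ↦
      eventuallyAddRe he X.as) :=
  isTriangulated_of_mappingCone (eventuallyAddRe he)
    (fun K hK ↦ by
      have hX (i : ℤ) : IsZero (K.X i) := Functor.map_isZero (HomologicalComplex.eval _ _ i) hK
      refine ⟨⟨complexProj_isZero K hK, ⟨0, (isStrictlyLE_iff _ _).2 fun i _ ↦ hX i⟩, ⟨0, ?_⟩⟩,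
        ⟨0, fun i _ ↦ addRe_of_isZero he (hX i)⟩⟩
      have : K.IsStrictlyGE 0 := (isStrictlyGE_iff _ _).2 fun i _ ↦ hX i
      infer_instance)
    (fun K n ⟨⟨h₁, ⟨a, _⟩, ⟨b, _⟩⟩, ⟨l, hl⟩⟩ ↦ ⟨⟨fun i ↦ h₁ (i + n),
      ⟨a - n, K.isStrictlyLE_shift a n (a - n) (by lia)⟩,
      ⟨b - n, K.isGE_shift b n (b - n) (by lia)⟩⟩, ⟨l - n, fun i _ ↦ hl (i + n) (by lia)⟩⟩)
    (fun {K L} f ⟨⟨h₁, ⟨a₁, _⟩, ⟨b₁, _⟩⟩, ⟨l₁, hl₁⟩⟩ ⟨⟨h₂, ⟨a₂, _⟩, ⟨b₂, _⟩⟩, ⟨l₂, hl₂⟩⟩ ↦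
      ⟨⟨complexProj_mappingCone f h₁ h₂, ⟨_, isStrictlyLE_mappingCone f a₁ a₂⟩,
        -- The cone has `K.X (i + 1) ⊞ L.X i` in degree `i`, whence `l₁ - 1`.
        ⟨_, isGE_mappingCone f b₁ b₂⟩⟩, ⟨min (l₁ - 1) l₂, fun i hi ↦
          addRe_of_retract he (Retract.ofIso (homotopyCofiber.XIsoBiprod f i (i + 1) rfl))
            (addRe_prod he (hl₁ (i + 1) (by lia)) (hl₂ i (by lia)))⟩⟩)

/-- The objects of `K^{-,b}(proj R)` that are isomorphic to a complex whose terms in sufficiently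
negative degrees belong to `add Re`. -/
abbrev kmbEventuallyAddRe : ObjectProperty (KmbCat R) :=
  (ObjectProperty.isoClosure
    (fun X : HomotopyCategory (ModuleCat.{u} R) (ComplexShape.up ℤ) ↦
      eventuallyAddRe he X.as)).inverseImage (Kmb R).ι

lemma perfect_le_kmbEventuallyAddRe : perfect R ≤ kmbEventuallyAddRe he := by
  rintro X ⟨B, ⟨h₁, h₂, ⟨b, hb⟩⟩, φ⟩
  obtain ⟨B : CochainComplex (ModuleCat.{u} R) ℤ⟩ := B
  have hb' : B.IsStrictlyGE b := hb
  have hb'' : B.IsGE b := inferInstance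
  exact ⟨_, ⟨⟨h₁, h₂, ⟨b, hb''⟩⟩, ⟨b - 1, fun i hi ↦
    addRe_of_isZero he (B.isZero_of_isStrictlyGE b i (by lia))⟩⟩, φ⟩

lemma kmbEventuallyAddRe_iLamKmb
    (h : ∀ X, Kmb he.Corner X →
      Kmb R (((iLam he).mapHomotopyCategory (ComplexShape.up ℤ)).obj X)) (X : KmbCat he.Corner) :
    kmbEventuallyAddRe he ((iLamKmb he h).obj X) := by
  refine ⟨_, ⟨h _ X.property, ⟨0, fun i _ ↦ ?_⟩⟩, ⟨Iso.refl _⟩⟩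
  obtain ⟨_, _⟩ := X.property.1 i
  exact addRe_iLam he (X.obj.as.X i)

end Eventually

/-! ### Resolutions from essential surjectivity. -/

section Converse

/-- A chain complex whose extension by zero is quasi-isomorphic to an object concentrated in
degree zero gives a projective resolution if it is degreewise projective. -/
lemma exists_projectiveResolution_of_extend {C : Type*} [Category* C] [Abelian C] {M : C}
    (Q : ChainComplex C ℕ) (hQ : ∀ n, Projective (Q.X n))
    (q : Q.extend (ComplexShape.embeddingUpIntLE 0) ⟶ (singleFunctor C 0).obj M) [QuasiIso q] :
    ∃ P : ProjectiveResolution M, P.complex = Q := by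
  let ε : ((ChainComplex.single₀ C).obj M).extend (ComplexShape.embeddingUpIntLE 0) ≅
      (singleFunctor C 0).obj M :=
    HomologicalComplex.extendSingleIso (ComplexShape.embeddingUpIntLE 0) M 0 0 (by simp)
  obtain ⟨π : Q ⟶ (ChainComplex.single₀ C).obj M, hπ⟩ :=
    ((ComplexShape.embeddingUpIntLE 0).extendFunctor C).map_surjective (q ≫ ε.inv)
  have : QuasiIso (extendMap π (ComplexShape.embeddingUpIntLE 0)) := by
    change QuasiIso (((ComplexShape.embeddingUpIntLE 0).extendFunctor C).map π)
    rw [hπ]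
    exact quasiIso_comp q ε.inv
  have : QuasiIso π := (quasiIso_extendMap_iff _ _).1 this
  exact ⟨{ complex := Q, projective := hQ, π := π }, rfl⟩

variable {R : Type u} [Ring R] {e : R} (he : IsIdempotentElem e)

/-- `W` may have terms in positive degrees, so its canonical truncation in degrees `≤ 0` is used;
this leaves the terms in negative degrees unchanged. -/
lemma exists_addRe_resolution {M : ModuleCat.{u} R} (P : ProjectiveResolution M)
    {W : CochainComplex (ModuleCat.{u} R) ℤ} (hW : eventuallyAddRe he W)
    (φ : (HomotopyCategory.quotient _ (ComplexShape.up ℤ)).obj P.cochainComplex ≅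
      (HomotopyCategory.quotient _ (ComplexShape.up ℤ)).obj W) :
    ∃ (l : ℤ) (Q : ProjectiveResolution M), (∀ i : ℕ, Module.Finite R (Q.complex.X i)) ∧
      ∀ i : ℕ, l ≤ i → addRe he (Q.complex.X i) := by
  obtain ⟨⟨hp, _, _⟩, ⟨l, hl⟩⟩ := hW
  obtain ⟨f, hf⟩ := (HomotopyCategory.quotient _ _).map_surjective φ.inv
  obtain ⟨g, hg⟩ := (HomotopyCategory.quotient _ _).map_surjective φ.hom
  have H : Homotopy (f ≫ g) (𝟙 W) := HomotopyCategory.homotopyOfEq _ _ (by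
    rw [Functor.map_comp, hf, hg, CategoryTheory.Functor.map_id, φ.inv_hom_id])
  have : IsIso ((HomotopyCategory.quotient _ (ComplexShape.up ℤ)).map f) := by
    rw [hf]
    infer_instance
  have hfq : QuasiIso f := homotopyEquivalences_le_quasiIso _ _ _
    ((isIso_quotient_map_iff_homotopyEquivalences f).1 this)
  have hLE : W.IsLE 0 := (isSupported_iff_of_quasiIso f _).2 inferInstance
  -- The resolution vanishes in degree `1`, so `W.d 0 1` is regular and the cycles in degree `0` are
  -- a summand of `W.X 0`, hence projective.
  obtain ⟨s, hs⟩ := exists_regular_of_isZero_right f g H (i := 0) (j := 1) rfl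
    (P.cochainComplex.isZero_of_isStrictlyLE 0 1)
  have hV : complexProj R (W.truncLE 0) := fun k ↦ by
    obtain hk | rfl | hk := lt_trichotomy k 0
    · exact finite_projective_of_iso (W.truncLEXIso 0 k hk) (hp k)
    · exact finite_projective_of_iso (W.truncLEXIsoCycles 0)
        (finite_projective_of_retract (retractCycles W rfl s hs) (hp 0))
    · exact finite_projective_of_isZero ((W.truncLE 0).isZero_of_isStrictlyLE 0 k hk)
  let ε := ComplexShape.embeddingUpIntLE 0
  let Q : ChainComplex (ModuleCat.{u} R) ℕ := HomologicalComplex.truncLE' W ε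
  let ψ : CochainComplex.truncLE W 0 ≅ Q.extend ε := HomologicalComplex.truncLEIso W ε
  let χ (n : ℕ) : Q.X n ≅ (CochainComplex.truncLE W 0).X (0 - n) :=
    (Q.extendXIso ε (i := n) rfl).symm ≪≫
      (HomologicalComplex.eval _ _ (0 - (n : ℤ))).mapIso ψ.symm
  have hQ (n : ℕ) := finite_projective_of_iso (χ n) (hV _)
  have : QuasiIso (ψ.inv ≫ W.ιTruncLE 0 ≫ f ≫ P.π') := by
    have := quasiIso_comp f P.π'
    have := quasiIso_comp (W.ιTruncLE 0) (f ≫ P.π')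
    exact quasiIso_comp _ _
  obtain ⟨P', hP'⟩ := exists_projectiveResolution_of_extend Q
    (fun n ↦ (IsProjective.iff_projective _).1 (hQ n).2)
    (ψ.inv ≫ W.ιTruncLE 0 ≫ f ≫ P.π')
  -- Index `0` is excluded because there the truncation has cycles in place of `W.X 0`.
  refine ⟨max 1 (-l), P', fun i ↦ hP' ▸ (hQ i).1, fun i hi ↦ hP' ▸ ?_⟩
  exact addRe_of_retract he (Retract.ofIso (χ i ≪≫ W.truncLEXIso 0 (0 - i) (by lia)))
    (hl _ (by lia))

variable
  (h : ∀ X, Kmb he.Corner X → Kmb R (((iLam he).mapHomotopyCategory (ComplexShape.up ℤ)).obj X))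
  (F : DSg he.Corner ⥤ DSg R) (α : quot he.Corner ⋙ F ≅ iLamKmb he h ⋙ quot R)

include α in
-- A resolution of `M` is isomorphic in `D_sg(R)` to some `i_λ X`, all of whose terms lie in `add
-- Re`; `prop_of_quot_iso` carries this back to the homotopy category for sufficiently negative
-- degrees.
lemma exists_addRe_resolution_of_essSurj [IsNoetherianRing R] [F.EssSurj] (M : ModuleCat.{u} R)
    (hM : Module.Finite R M) :
    ∃ (l : ℤ) (P : ProjectiveResolution M), (∀ i : ℕ, Module.Finite R (P.complex.X i)) ∧
      ∀ i : ℕ, l ≤ i → addRe he (P.complex.X i) := by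
  obtain ⟨P, hP⟩ := exists_finite_projectiveResolution M hM
  have hPM := complexMb_cochainComplex P hP
  have : (quot he.Corner).EssSurj := Localization.essSurj _ (perfect he.Corner).trW
  let Z := F.objPreimage ((quot R).obj (toKmb hPM))
  let X := (quot he.Corner).objPreimage Z
  let φ : (quot R).obj (toKmb hPM) ≅ (quot R).obj ((iLamKmb he h).obj X) :=
    (F.objObjPreimageIso _).symm ≪≫ F.mapIso ((quot he.Corner).objObjPreimageIso Z).symm ≪≫
      α.app X
  obtain ⟨W, hW, ⟨ψ⟩⟩ := prop_of_quot_iso (kmbEventuallyAddRe he)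
    (perfect_le_kmbEventuallyAddRe he) φ (kmbEventuallyAddRe_iLamKmb he h X)
  obtain ⟨W : CochainComplex (ModuleCat.{u} R) ℤ⟩ := W
  exact exists_addRe_resolution he P hW ψ

end Converse

end SingCat

open SingCat CategoryTheory in
theorem theoremA {R : Type u} [Ring R] [IsNoetherianRing R] {e : R} (he : IsIdempotentElem e)
    (hpd : projectiveDimension (ModuleCat.of (he.Corner)ᵐᵒᵖ (LeftRe he)) < ⊤) :
    ∃ (h : ∀ X, Kmb he.Corner X →
        Kmb R (((iLam he).mapHomotopyCategory (ComplexShape.up ℤ)).obj X))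
      (F : DSg he.Corner ⥤ DSg R) (_ : F.CommShift ℤ)
      (α : quot he.Corner ⋙ F ≅ iLamKmb he h ⋙ quot R),
      NatTrans.CommShift α.hom ℤ ∧ F.IsTriangulated ∧ F.Full ∧ F.Faithful ∧
      (F.IsEquivalence ↔
        ∀ (M : ModuleCat.{u} R), Module.Finite R M →
          ∃ (l : ℤ) (P : ProjectiveResolution M),
            (∀ i : ℕ, Module.Finite R (P.complex.X i)) ∧
            ∀ i : ℕ, l ≤ i → addRe he (P.complex.X i)) := by
  have h := kmb_iLam he hpd
  obtain ⟨F, hF, α, hα, _, _, _⟩ := exists_fullyFaithful_verdier_lift (iLamKmb he h)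
    (perfect he.Corner) (perfect R) (perfect_iLamKmb he h)
    (fun _ _ f hW ↦ exists_factorization_iLamKmb he h f hW)
  refine ⟨h, F, hF, α, hα, inferInstance, inferInstance, inferInstance, fun _ M hM ↦ ?_,
    fun hres ↦ ?_⟩
  · exact exists_addRe_resolution_of_essSurj he h F α M hM
  · have := essSurj_of_resolutions he h F α hres
    exact { }
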